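/- Let $k$ be a field of characteristic $0$ and let $V=V_0\oplus V_1$ be a $\mathbb Z_2$-graded vector space over $k$ with an inner product $\langle\cdot,\cdot\rangle$, that is, an even, graded symmetric ($\langle v,w\rangle=(-1)^{|v||w|}\langle w,v\rangle$), nondegenerate bilinear form. Let $W=\Pi V$ be the parity reversion, with the odd identity map $\pi:V\to W$, and let $\bigodot W=\bigoplus_{n\ge1}\bigodot^nW$ be the reduced graded symmetric coalgebra. A cochain is a linear map $\varphi:\bigodot W\to W$, or equivalently the family of graded antisymmetric maps $\varphi_n:V^n\to V$, $n\ge 1$, $$\varphi_n(v_1,\dots,v_n)=(-1)^{(n-1)|v_1|+(n-2)|v_2|+\cdots+|v_{n-1}|}\,\pi^{-1}\varphi(\pi v_1\odot\cdots\odot\pi v_n);$$ $\hat\varphi$ denotes the coderivation of $\bigodot W$ that extends $\varphi$. If $\varphi$ has parity $r$ as a map $\bigodot W\to W$, then $\varphi_n$ has parity $r+n+1$, and $\varphi$ is called cyclic if for all $n\ge1$ $$\langle\varphi_n(v_1,\dots,v_n),v_{n+1}\rangle=(-1)^{n+|v_1||\varphi_n|}\langle v_1,\varphi_n(v_2,\dots,v_{n+1})\rangle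 .$$ Let $l$ be an $L_\infty$ structure on $V$ (an odd cochain $l:\bigodot W\to W$ with $\hat l^2=0$) for which the inner product is invariant, i.e. $l$ is cyclic. Let $CC^r$ be the space of cyclic cochains of parity $r\in\mathbb Z_2$, and put $D\varphi=[\varphi,l]=\varphi\circ\hat l-(-1)^{r}\,l\circ\hat\varphi$ for $\varphi$ of parity $r$. Let $t$ be a parameter of parity $p\in\mathbb Z_2$ with $t^2=0$ that commutes with everything up to the Koszul sign. An infinitesimal deformation of $l$ is $l_t=l+t\varphi$, $\varphi$ a cochain, such that $\hat l+t\hat\varphi$ is odd and of square zero on $\bigodot W[t]$; it preserves the inner product if the inner product, extended to $V[t]$, is invariant for $l_t$. Two such deformations are called equivalent if an even $k[t]$-linear automorphism $F$ of the coalgebra $\bigodot W[t]$, equal to the identity modulo $t$ and preserving the inner product, carries the first codifferential to the second; a deformation is trivial if it is equivalent to $l$. Here $F$, with components $f:\bigodot W\to W[t]$, preserves the inner product if it preserves, as a formal change of coordinates, the form $\omega(\pi a,\pi b)=(-1)^{|a|}\langle a,b\rangle$ on $W$: for homogeneous $u,w\in W$ and $x=w_1\odot\cdots\odot w_m$, $m\ge0$,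 $$\sum(-1)^{|u||x''|}\,\omega\big(f(x'\odot u),f(x''\odot w)\big)=\begin{cases}\omega(u,w)&m=0,\\0&m>0,\end{cases}$$ where $\sum x'\otimes x''$ is the full coproduct of $x$ (for linear $F$ this says that $F$ preserves $\langle\cdot,\cdot\rangle$). Then: (a) $D$ maps $CC^r$ to $CC^{r+1}$ and $D^2=0$ on $CC^r$, so that the cyclic cohomology $HC(V)=HC^0(V)\oplus HC^1(V)$, $HC^r(V)=\ker(D|_{CC^r})/D(CC^{r+1})$, is defined. And for each parity $p$ of $t$: (b) $l+t\varphi$ is an infinitesimal deformation of $l$ that preserves the inner product if and only if $\varphi$ is a cyclic cocycle of parity $p+1$. (c) $l+t\varphi$ is a trivial infinitesimal deformation preserving the inner product if and only if $\varphi\in D(CC^{p})$, i.e. $\varphi$ is a cyclic coboundary of parity $p+1$; two infinitesimal deformations $l+t\varphi$, $l+t\psi$ that preserve the inner product are equivalent if and only if $\psi-\varphi\in D(CC^{p})$. (d) Consequently $[\varphi]\mapsto[l+t\varphi]$ is a well-defined bijection from $HC^{p+1}(V)$ onto the set of equivalence classes of infinitesimal deformations of $l$, with parameter of parity $p$, that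 preserve the inner product. -/

import Mathlib

open scoped TensorProduct

noncomputable section

namespace LInf

/-! ### Parities and signs -/

section Parity

variable (K : Type*) [Field K]

/-- The sign `(-1)^i` of a parity `i`. -/
def sgn (i : ZMod 2) : K := if i = 0 then 1 else -1

variable {K} {W : Type*} [AddCommGroup W] [Module K W]

/-- Parity reversion: the same space, with the parity of the elements reversed. The map `π` from
a space to its parity reversion is the identity on elements. -/
def rev (𝒲 : ZMod 2 → Submodule K W) : ZMod 2 → Submodule K W := fun i => 𝒲 (i + 1)

theorem le_rev (𝒲 : ZMod 2 → Submodule K W) (i : ZMod 2) : 𝒲 i ≤ rev 𝒲 (i + 1) := by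
  have h : i + 1 + 1 = i := by revert i; decide
  intro x hx
  simpa only [rev, h] using hx

instance instDecompositionRev (𝒲 : ZMod 2 → Submodule K W) [DirectSum.Decomposition 𝒲] :
    DirectSum.Decomposition (rev 𝒲) :=
  DirectSum.Decomposition.ofLinearMap (rev 𝒲)
    (DirectSum.toModule K (ZMod 2) _
        (fun i => DirectSum.lof K (ZMod 2) (fun j => rev 𝒲 j) (i + 1) ∘ₗ
          Submodule.inclusion (le_rev 𝒲 i)) ∘ₗ
      (DirectSum.decomposeLinearEquiv 𝒲).toLinearMap)
    (by
      refine LinearMap.ext fun x => ?_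
      induction x using DirectSum.Decomposition.inductionOn 𝒲 with
      | zero => simp
      | homogeneous m => simp
      | add a b ha hb => rw [map_add, ha, hb, map_add])
    (by
      refine DirectSum.linearMap_ext K fun i => LinearMap.ext fun x => ?_
      have h : i = i + 1 + 1 := by
        clear x
        revert i
        decide
      obtain ⟨x, hx⟩ := x
      have e : DirectSum.decompose 𝒲 x =
          DirectSum.lof K (ZMod 2) (fun j => 𝒲 j) (i + 1) ⟨x, hx⟩ :=
        DirectSum.decompose_of_mem 𝒲 hx
      simp only [LinearMap.comp_apply, DirectSum.coeLinearMap_lof, LinearEquiv.coe_coe,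
        DirectSum.decomposeLinearEquiv_apply, e, DirectSum.toModule_lof, LinearMap.id_apply]
      refine DFinsupp.single_eq_of_sigma_eq (Sigma.ext h.symm ?_)
      congr!
      exact h.symm)

/-- The projection onto the homogeneous component of parity `i`. -/
def grProj (𝒲 : ZMod 2 → Submodule K W) [DirectSum.Decomposition 𝒲] (i : ZMod 2) : W →ₗ[K] W :=
  (𝒲 i).subtype ∘ₗ DirectSum.component K (ZMod 2) (fun j => 𝒲 j) i ∘ₗ
    (DirectSum.decomposeLinearEquiv 𝒲).toLinearMap

theorem grProj_of_mem (𝒲 : ZMod 2 → Submodule K W) [DirectSum.Decomposition 𝒲] {i : ZMod 2}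
    {w : W} (hw : w ∈ 𝒲 i) (j : ZMod 2) : grProj 𝒲 j w = if j = i then w else 0 := by
  change ((DirectSum.decompose 𝒲 w j : 𝒲 j) : W) = _
  split_ifs with h
  · subst h
    exact DirectSum.decompose_of_mem_same 𝒲 hw
  · exact DirectSum.decompose_of_mem_ne 𝒲 hw (Ne.symm h)

/-- The parity operator `w ↦ (-1)^|w| w`. -/
def parityOp (𝒲 : ZMod 2 → Submodule K W) [DirectSum.Decomposition 𝒲] : W →ₗ[K] W :=
  grProj 𝒲 0 - grProj 𝒲 1

theorem parityOp_of_mem (𝒲 : ZMod 2 → Submodule K W) [DirectSum.Decomposition 𝒲] {i : ZMod 2}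
    {w : W} (hw : w ∈ 𝒲 i) : parityOp 𝒲 w = sgn K i • w := by
  simp only [parityOp, LinearMap.sub_apply, grProj_of_mem 𝒲 hw]
  obtain rfl | rfl : i = 0 ∨ i = 1 := by
    clear hw
    revert i
    decide
  · simp [sgn]
  · simp [sgn]

/-- Given the parity operator `P` of a space, the operator `x ↦ (-1)^(i|x|) x`. -/
def tw {M : Type*} [AddCommMonoid M] [Module K M] (i : ZMod 2) (P : M →ₗ[K] M) : M →ₗ[K] M :=
  if i = 0 then LinearMap.id else P

/-- A linear map between spaces with parity operators `P` and `Q` is homogeneous of parity `r`. -/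
def HasParity {M N : Type*} [AddCommMonoid M] [Module K M] [AddCommMonoid N] [Module K N]
    (P : M →ₗ[K] M) (Q : N →ₗ[K] N) (r : ZMod 2) (f : M →ₗ[K] N) : Prop :=
  Q ∘ₗ f = sgn K r • (f ∘ₗ P)

end Parity

/-! ### The graded symmetric algebra and the reduced symmetric coalgebra -/

section Symmetric

variable {K : Type*} [Field K] {W : Type*} [AddCommGroup W] [Module K W]

/-- The relations `a ⊙ b = (-1)^(|a||b|) b ⊙ a`. -/
inductive SymRel (𝒲 : ZMod 2 → Submodule K W) : TensorAlgebra K W → TensorAlgebra K W → Prop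
  | comm (i j : ZMod 2) (a b : W) (ha : a ∈ 𝒲 i) (hb : b ∈ 𝒲 j) :
      SymRel 𝒲 (TensorAlgebra.ι K a * TensorAlgebra.ι K b)
        (sgn K (i * j) • (TensorAlgebra.ι K b * TensorAlgebra.ι K a))

/-- The graded symmetric algebra of `W`, with its unit. -/
def Sym (𝒲 : ZMod 2 → Submodule K W) : Type _ := RingQuot (SymRel 𝒲)

instance instRingSym (𝒲 : ZMod 2 → Submodule K W) : Ring (Sym 𝒲) :=
  inferInstanceAs (Ring (RingQuot (SymRel 𝒲)))

instance instAlgebraSym (𝒲 : ZMod 2 → Submodule K W) : Algebra K (Sym 𝒲) :=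
  inferInstanceAs (Algebra K (RingQuot (SymRel 𝒲)))

/-- The quotient map from the tensor algebra. -/
def symMk (𝒲 : ZMod 2 → Submodule K W) : TensorAlgebra K W →ₐ[K] Sym 𝒲 :=
  RingQuot.mkAlgHom K (SymRel 𝒲)

/-- The inclusion of `W` in its symmetric algebra. -/
def inc (𝒲 : ZMod 2 → Submodule K W) : W →ₗ[K] Sym 𝒲 :=
  (symMk 𝒲).toLinearMap ∘ₗ TensorAlgebra.ι K

theorem inc_mul_inc (𝒲 : ZMod 2 → Submodule K W) {i j : ZMod 2} {a b : W} (ha : a ∈ 𝒲 i)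
    (hb : b ∈ 𝒲 j) : inc 𝒲 a * inc 𝒲 b = sgn K (i * j) • (inc 𝒲 b * inc 𝒲 a) := by
  have h : symMk 𝒲 _ = symMk 𝒲 _ :=
    RingQuot.mkAlgHom_rel K (SymRel.comm (𝒲 := 𝒲) i j a b ha hb)
  simpa [inc] using h

/-- The universal property of the symmetric algebra. -/
def symLift (𝒲 : ZMod 2 → Submodule K W) {A : Type*} [Semiring A] [Algebra K A] (f : W →ₗ[K] A)
    (hf : ∀ (i j : ZMod 2) (a b : W), a ∈ 𝒲 i → b ∈ 𝒲 j →
      f a * f b = sgn K (i * j) • (f b * f a)) : Sym 𝒲 →ₐ[K] A :=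
  RingQuot.liftAlgHom K ⟨TensorAlgebra.lift K f, by
    rintro _ _ ⟨i, j, a, b, ha, hb⟩
    simpa using hf i j a b ha hb⟩

@[simp]
theorem symLift_inc (𝒲 : ZMod 2 → Submodule K W) {A : Type*} [Semiring A] [Algebra K A]
    (f : W →ₗ[K] A) (hf : ∀ (i j : ZMod 2) (a b : W), a ∈ 𝒲 i → b ∈ 𝒲 j →
      f a * f b = sgn K (i * j) • (f b * f a)) (w : W) : symLift 𝒲 f hf (inc 𝒲 w) = f w := by
  have h : symLift 𝒲 f hf (inc 𝒲 w) = TensorAlgebra.lift K f (TensorAlgebra.ι K w) :=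
    RingQuot.liftAlgHom_mkAlgHom_apply K _ _ _
  rw [h, TensorAlgebra.lift_ι_apply]

/-- The augmentation: it is the identity on scalars and kills `W`. -/
def aug (𝒲 : ZMod 2 → Submodule K W) : Sym 𝒲 →ₐ[K] K :=
  symLift 𝒲 0 (by simp)

/-- The algebra map that underlies the projection to the part of degree one: `w` acts on `K × W`
by `(c, v) ↦ (0, c w)`. -/
def degOneAux (𝒲 : ZMod 2 → Submodule K W) : Sym 𝒲 →ₐ[K] Module.End K (K × W) :=
  symLift 𝒲
    { toFun := fun w =>
        LinearMap.inr K K W ∘ₗ LinearMap.toSpanSingleton K W w ∘ₗ LinearMap.fst K K W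
      map_add' := fun a b => by ext <;> simp
      map_smul' := fun c a => by ext <;> simp }
    (by
      intro i j a b _ _
      ext <;> simp)

/-- The projection of the symmetric algebra onto its part `W` of degree one. -/
def degOne (𝒲 : ZMod 2 → Submodule K W) : Sym 𝒲 →ₗ[K] W :=
  LinearMap.snd K K W ∘ₗ LinearMap.applyₗ (1, 0) ∘ₗ (degOneAux 𝒲).toLinearMap

/-- The reduced symmetric coalgebra, as a space: the sum of the symmetric powers `⊙ⁿ W`
for `n ≥ 1`. -/
abbrev RSym (𝒲 : ZMod 2 → Submodule K W) : Type _ := ↥(LinearMap.ker (aug 𝒲).toLinearMap)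

/-- The projection of the symmetric algebra onto its part of positive degree. -/
def red (𝒲 : ZMod 2 → Submodule K W) : Sym 𝒲 →ₗ[K] RSym 𝒲 :=
  LinearMap.codRestrict _
    (LinearMap.id - Algebra.linearMap K (Sym 𝒲) ∘ₗ (aug 𝒲).toLinearMap)
    (fun x => by simp)

/-- The inclusion of the part of positive degree. -/
def incl (𝒲 : ZMod 2 → Submodule K W) : RSym 𝒲 →ₗ[K] Sym 𝒲 :=
  (LinearMap.ker (aug 𝒲).toLinearMap).subtype

variable (𝒲 : ZMod 2 → Submodule K W) [DirectSum.Decomposition 𝒲]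

/-- The parity operator of the symmetric algebra,
`w₁ ⊙ ⋯ ⊙ wₙ ↦ (-1)^(|w₁| + ⋯ + |wₙ|) w₁ ⊙ ⋯ ⊙ wₙ`. -/
def symPar : Sym 𝒲 →ₐ[K] Sym 𝒲 :=
  symLift 𝒲 (inc 𝒲 ∘ₗ parityOp 𝒲) (by
    intro i j a b ha hb
    simp only [LinearMap.comp_apply, parityOp_of_mem 𝒲 ha, parityOp_of_mem 𝒲 hb, map_smul,
      smul_mul_smul_comm, inc_mul_inc 𝒲 ha hb, smul_smul]
    ring_nf)

theorem symPar_inc_mul {i : ZMod 2} {w : W} (hw : w ∈ 𝒲 i) (x : Sym 𝒲) :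
    symPar 𝒲 (inc 𝒲 w * x) = sgn K i • (inc 𝒲 w * symPar 𝒲 x) := by
  have h : symPar 𝒲 (inc 𝒲 w) = sgn K i • inc 𝒲 w := by
    rw [symPar, symLift_inc, LinearMap.comp_apply, parityOp_of_mem 𝒲 hw, map_smul]
  rw [map_mul, h, smul_mul_assoc]

/-- Left multiplication by `w ⊗ 1 + 1 ⊗ w` on `Sym ⊗ Sym`, with the Koszul sign rule:
`x ⊗ y ↦ (w ⊙ x) ⊗ y + (-1)^(|w||x|) x ⊗ (w ⊙ y)`. -/
def primMul : W →ₗ[K] Module.End K (Sym 𝒲 ⊗[K] Sym 𝒲) where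
  toFun w := TensorProduct.map (LinearMap.mulLeft K (inc 𝒲 w)) LinearMap.id +
    ∑ i : ZMod 2, TensorProduct.map (tw i (symPar 𝒲).toLinearMap)
      (LinearMap.mulLeft K (inc 𝒲 (grProj 𝒲 i w)))
  map_add' a b := by
    ext x y
    simp [add_mul, TensorProduct.add_tmul, TensorProduct.tmul_add, Finset.sum_add_distrib]
    abel
  map_smul' c a := by
    ext x y
    simp [TensorProduct.smul_tmul', Finset.smul_sum]

theorem primMul_tmul {i : ZMod 2} {w : W} (hw : w ∈ 𝒲 i) (x y : Sym 𝒲) :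
    primMul 𝒲 w (x ⊗ₜ y) = (inc 𝒲 w * x) ⊗ₜ[K] y +
      tw i (symPar 𝒲).toLinearMap x ⊗ₜ[K] (inc 𝒲 w * y) := by
  have h : ∀ j, TensorProduct.map (tw j (symPar 𝒲).toLinearMap)
      (LinearMap.mulLeft K (inc 𝒲 (grProj 𝒲 j w))) (x ⊗ₜ[K] y) =
      if j = i then tw i (symPar 𝒲).toLinearMap x ⊗ₜ[K] (inc 𝒲 w * y) else 0 := by
    intro j
    rw [grProj_of_mem 𝒲 hw]
    split_ifs with hj
    · subst hj; simp
    · simp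
  simp [primMul, LinearMap.sum_apply, h]

/-- The algebra map by which `Sym` acts on `Sym ⊗ Sym` through the coproduct. -/
def coprodAux : Sym 𝒲 →ₐ[K] Module.End K (Sym 𝒲 ⊗[K] Sym 𝒲) :=
  symLift 𝒲 (primMul 𝒲) (by
    intro i j a b ha hb
    have key : ∀ (k l : ZMod 2) (c : W), c ∈ 𝒲 k → ∀ x : Sym 𝒲,
        tw l (symPar 𝒲).toLinearMap (inc 𝒲 c * x) =
          sgn K (l * k) • (inc 𝒲 c * tw l (symPar 𝒲).toLinearMap x) := by
      intro k l c hc x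
      obtain rfl | rfl : l = 0 ∨ l = 1 := by
        revert l
        decide
      · simp [tw, sgn]
      · simp [tw, symPar_inc_mul 𝒲 hc]
    have comm : ∀ x : Sym 𝒲, tw i (symPar 𝒲).toLinearMap (tw j (symPar 𝒲).toLinearMap x) =
        tw j (symPar 𝒲).toLinearMap (tw i (symPar 𝒲).toLinearMap x) := by
      intro x
      simp only [tw]
      split_ifs <;> simp
    have assoc : ∀ x : Sym 𝒲, inc 𝒲 a * (inc 𝒲 b * x) =
        sgn K (i * j) • (inc 𝒲 b * (inc 𝒲 a * x)) := by
      intro x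
      rw [← mul_assoc, inc_mul_inc 𝒲 ha hb, smul_mul_assoc, mul_assoc]
    have hs : sgn K (i * j) * sgn K (i * j) = 1 := by
      simp only [sgn]; split_ifs <;> simp
    refine TensorProduct.ext' fun x y => ?_
    simp only [Module.End.mul_apply, LinearMap.smul_apply, primMul_tmul 𝒲 ha,
      primMul_tmul 𝒲 hb, map_add, key _ _ _ ha, key _ _ _ hb, comm, assoc, smul_add,
      TensorProduct.smul_tmul', TensorProduct.tmul_smul, smul_smul, mul_comm j i, hs, one_smul]
    abel)

/-- The coproduct of the symmetric algebra, the map that is multiplicative for the Koszul sign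
rule with `w ↦ w ⊗ 1 + 1 ⊗ w`. On a product it is the signed sum over unshuffles
`∑ₖ ∑_σ ε(σ) (w_σ(1) ⊙ ⋯ ⊙ w_σ(k)) ⊗ (w_σ(k+1) ⊙ ⋯ ⊙ w_σ(n))`, for `0 ≤ k ≤ n`. -/
def coprod : Sym 𝒲 →ₗ[K] Sym 𝒲 ⊗[K] Sym 𝒲 :=
  LinearMap.applyₗ (1 ⊗ₜ[K] 1) ∘ₗ (coprodAux 𝒲).toLinearMap

theorem coprod_one : coprod 𝒲 1 = 1 ⊗ₜ[K] 1 := by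
  simp [coprod]

theorem coprod_inc_mul (w : W) (x : Sym 𝒲) :
    coprod 𝒲 (inc 𝒲 w * x) = primMul 𝒲 w (coprod 𝒲 x) := by
  simp [coprod, coprodAux]

/-- The parity operator of the reduced symmetric coalgebra. -/
def rPar : RSym 𝒲 →ₗ[K] RSym 𝒲 := red 𝒲 ∘ₗ (symPar 𝒲).toLinearMap ∘ₗ incl 𝒲

/-- The diagonal of the reduced symmetric coalgebra (the terms `1 ⊗ x` and `x ⊗ 1` of the
coproduct are left out: unshuffles with `1 ≤ k ≤ n - 1`). -/
def rDiag : RSym 𝒲 →ₗ[K] RSym 𝒲 ⊗[K] RSym 𝒲 :=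
  TensorProduct.map (red 𝒲) (red 𝒲) ∘ₗ coprod 𝒲 ∘ₗ incl 𝒲

/-- The coderivation of the reduced symmetric coalgebra that extends `φ : ⊙W → W`:
`w₁ ⊙ ⋯ ⊙ wₙ ↦ ∑ₖ ∑_σ ε(σ) φₖ(w_σ(1), …, w_σ(k)) ⊙ w_σ(k+1) ⊙ ⋯ ⊙ w_σ(n)`,
over `1 ≤ k ≤ n` and unshuffles `σ` of type `(k, n - k)`. -/
def hat : (RSym 𝒲 →ₗ[K] W) →ₗ[K] (RSym 𝒲 →ₗ[K] RSym 𝒲) where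
  toFun φ := red 𝒲 ∘ₗ LinearMap.mul' K (Sym 𝒲) ∘ₗ
    TensorProduct.map (inc 𝒲 ∘ₗ φ ∘ₗ red 𝒲) LinearMap.id ∘ₗ coprod 𝒲 ∘ₗ incl 𝒲
  map_add' φ ψ := by
    simp only [LinearMap.add_comp, LinearMap.comp_add, TensorProduct.map_add_left]
  map_smul' c φ := by
    simp only [LinearMap.smul_comp, LinearMap.comp_smul, TensorProduct.map_smul_left,
      RingHom.id_apply]

end Symmetric

/-! ### Extension of scalars to `K[t]`, `t² = 0`, with `t` of parity `p`

The space `M[t] = M ⊕ tM` is `M × M`, where `(x, y)` stands for `x + t y`. The parameter `t`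
commutes with everything up to the Koszul sign. -/

section Infinitesimal

variable {K : Type*} [Field K] {M N R : Type*} [AddCommMonoid M] [Module K M] [AddCommMonoid N]
  [Module K N] [AddCommMonoid R] [Module K R]

/-- The parity operator of `M[t]`. -/
def parT (p : ZMod 2) (P : M →ₗ[K] M) : (M × M) →ₗ[K] (M × M) :=
  LinearMap.prodMap P (sgn K p • P)

/-- Multiplication by `t`. -/
def mulT : (M × M) →ₗ[K] (M × M) := LinearMap.inr K M M ∘ₗ LinearMap.fst K M M

/-- The `t`-linear operator `A + tB` on `M[t]`, for `A` of parity `a`: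
`(A + tB)(x + t y) = A x + t (B x + (-1)^(pa) A y)`. -/
def opT (p a : ZMod 2) (A B : M →ₗ[K] M) : (M × M) →ₗ[K] (M × M) :=
  LinearMap.prod (A ∘ₗ LinearMap.fst K M M)
    (B ∘ₗ LinearMap.fst K M M + sgn K (p * a) • (A ∘ₗ LinearMap.snd K M M))

/-- The `t`-bilinear extension of an even bilinear map `β` on `M × N`, where `P` is the parity
operator of `M`: `β(a + t b, c + t d) = β(a, c) + t (β(b, c) + (-1)^(p|a|) β(a, d))`. -/
def bilT (p : ZMod 2) (P : M →ₗ[K] M) (β : M →ₗ[K] N →ₗ[K] R) :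
    (M × M) →ₗ[K] (N × N) →ₗ[K] (R × R) :=
  LinearMap.mk₂ K (fun x y => (β x.1 y.1, β x.2 y.1 + β (tw p P x.1) y.2))
    (fun x x' y => by ext <;> simp; abel)
    (fun c x y => by ext <;> simp)
    (fun x y y' => by ext <;> simp; abel)
    (fun c x y => by ext <;> simp)

end Infinitesimal

/-! ### `L∞` algebras, inner products, cyclic cohomology -/

section Cochains

variable {K : Type*} [Field K] {V : Type*} [AddCommGroup V] [Module K V]
variable (𝒱 : ZMod 2 → Submodule K V)

/-- The module of cochains of the graded space `V`, in terms of the parity reversion `W` of `V`: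
`C(V) ≅ C(W) = Hom(⊙W, W)`. The corresponding graded antisymmetric maps `Vⁿ → V` are given
by `component`. -/
abbrev Cochain : Type _ := RSym (rev 𝒱) →ₗ[K] V

/-- The `n`-th component `φₙ : Vⁿ → V` of a cochain, at homogeneous `v₁, …, vₙ` of parities
`i₁, …, iₙ`: `φₙ(v₁, …, vₙ) = (-1)^((n-1)v₁ + ⋯ + vₙ₋₁) π⁻¹ φ(πv₁ ⊙ ⋯ ⊙ πvₙ)`. The values may
lie in `V` or in `V[t]`. -/
def component {X : Type*} [AddCommMonoid X] [Module K X] (φ : RSym (rev 𝒱) →ₗ[K] X) {n : ℕ}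
    (i : Fin n → ZMod 2) (v : Fin n → V) : X :=
  sgn K (∑ k : Fin n, ((n - 1 - (k : ℕ) : ℕ) : ZMod 2) * i k) •
    φ (red (rev 𝒱) (List.ofFn fun k => inc (rev 𝒱) (v k)).prod)

/-- An even inner product: a bilinear form that is even, graded symmetric and nondegenerate. -/
structure IsInnerProduct (B : LinearMap.BilinForm K V) : Prop where
  even : ∀ (i j : ZMod 2) (x y : V), x ∈ 𝒱 i → y ∈ 𝒱 j → i ≠ j → B x y = 0
  symm : ∀ (i j : ZMod 2) (x y : V), x ∈ 𝒱 i → y ∈ 𝒱 j → B x y = sgn K (i * j) * B y x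
  nondegenerate : B.Nondegenerate

/-- A cochain `φ` that is of parity `r` on `W` (so that `φₙ` has parity `r + n + 1` on `V`) is
cyclic if
`⟨φₙ(v₁, …, vₙ), vₙ₊₁⟩ = (-1)^(n + v₁ φₙ) ⟨v₁, φₙ(v₂, …, vₙ₊₁)⟩` for all `n ≥ 1`. -/
def IsCyclicCochain (B : LinearMap.BilinForm K V) (r : ZMod 2) (φ : Cochain 𝒱) : Prop :=
  ∀ (n : ℕ) (i : Fin (n + 1) → ZMod 2) (v : Fin (n + 1) → V), 1 ≤ n → (∀ k, v k ∈ 𝒱 (i k)) →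
    B (component 𝒱 φ (fun k => i (Fin.castSucc k)) (fun k => v (Fin.castSucc k)))
        (v (Fin.last n)) =
      sgn K ((n : ZMod 2) + i 0 * (r + n + 1)) *
        B (v 0) (component 𝒱 φ (fun k => i (Fin.succ k)) (fun k => v (Fin.succ k)))

variable [DirectSum.Decomposition 𝒱]

/-- An `L∞` structure: an odd cochain `l` on `W` whose coderivation has square zero. -/
structure IsLInfty (l : Cochain 𝒱) : Prop where
  odd : HasParity (rPar (rev 𝒱)) (parityOp (rev 𝒱)) 1 l
  sq_zero : hat (rev 𝒱) l ∘ₗ hat (rev 𝒱) l = 0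

/-- The coboundary `D φ = [φ, l] = φ ∘ l̂ - (-1)^r l ∘ φ̂` on cochains `φ` of parity `r`. -/
def cobd (l : Cochain 𝒱) (r : ZMod 2) : Cochain 𝒱 →ₗ[K] Cochain 𝒱 :=
  LinearMap.lcomp K V (hat (rev 𝒱) l) -
    sgn K r • (LinearMap.llcomp K (RSym (rev 𝒱)) (RSym (rev 𝒱)) V l ∘ₗ hat (rev 𝒱))

/-- The cyclic cochains of parity `r`. -/
def CC (B : LinearMap.BilinForm K V) (r : ZMod 2) : Submodule K (Cochain 𝒱) where
  carrier := {φ | HasParity (rPar (rev 𝒱)) (parityOp (rev 𝒱)) r φ ∧ IsCyclicCochain 𝒱 B r φ}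
  zero_mem' := ⟨by simp [HasParity], fun n i v _ _ => by simp [component]⟩
  add_mem' := by
    rintro φ ψ ⟨h1, h2⟩ ⟨h3, h4⟩
    refine ⟨?_, fun n i v hn hv => ?_⟩
    · unfold HasParity at *
      rw [LinearMap.comp_add, h1, h3, LinearMap.add_comp, smul_add]
    · have e1 := h2 n i v hn hv
      have e2 := h4 n i v hn hv
      simp only [component, LinearMap.add_apply, smul_add, map_add] at e1 e2 ⊢
      rw [e1, e2]
      exact (mul_add _ _ _).symm
  smul_mem' := by
    rintro c φ ⟨h1, h2⟩
    refine ⟨?_, fun n i v hn hv => ?_⟩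
    · unfold HasParity at *
      rw [LinearMap.comp_smul, h1, LinearMap.smul_comp, smul_comm]
    · have e1 := h2 n i v hn hv
      simp only [component, LinearMap.smul_apply, map_smul, smul_eq_mul] at e1 ⊢
      linear_combination c * e1

/-- The cyclic cocycles of parity `r`. -/
def cocycles (B : LinearMap.BilinForm K V) (l : Cochain 𝒱) (r : ZMod 2) :
    Submodule K (Cochain 𝒱) :=
  CC 𝒱 B r ⊓ LinearMap.ker (cobd 𝒱 l r)

/-- The cyclic coboundaries of parity `r`: the coboundaries of cyclic cochains of parity `r + 1`
(which is `r - 1`). -/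
def coboundaries (B : LinearMap.BilinForm K V) (l : Cochain 𝒱) (r : ZMod 2) :
    Submodule K (Cochain 𝒱) :=
  (CC 𝒱 B (r + 1)).map (cobd 𝒱 l (r + 1))

/-- The part of parity `r` of the cyclic cohomology, `HC(V) = HC⁰(V) ⊕ HC¹(V)`. -/
abbrev HC (B : LinearMap.BilinForm K V) (l : Cochain 𝒱) (r : ZMod 2) : Type _ :=
  ↥(cocycles 𝒱 B l r) ⧸ (coboundaries 𝒱 B l r).submoduleOf (cocycles 𝒱 B l r)

/-! ### Infinitesimal deformations -/

/-- The coderivation `d_t = l̂ + t φ̂` of `⊙W[t]`. -/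
def defOp (p : ZMod 2) (l φ : Cochain 𝒱) :
    (RSym (rev 𝒱) × RSym (rev 𝒱)) →ₗ[K] (RSym (rev 𝒱) × RSym (rev 𝒱)) :=
  opT p 1 (hat (rev 𝒱) l) (hat (rev 𝒱) φ)

/-- `l + tφ`, with `t` of parity `p`, is an infinitesimal deformation of `l`: an odd
codifferential on `⊙W[t]`. -/
structure IsDeformation (p : ZMod 2) (l φ : Cochain 𝒱) : Prop where
  odd : HasParity (parT p (rPar (rev 𝒱))) (parT p (rPar (rev 𝒱))) 1 (defOp 𝒱 p l φ)
  sq_zero : defOp 𝒱 p l φ ∘ₗ defOp 𝒱 p l φ = 0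

/-- The deformed structure, transferred to `V`: `π⁻¹(l + tφ) = π⁻¹l + (-1)^p t π⁻¹φ`. -/
def defCochain (p : ZMod 2) (l φ : Cochain 𝒱) : RSym (rev 𝒱) →ₗ[K] V × V :=
  LinearMap.prod l (sgn K p • φ)

/-- The inner product, extended to `V[t]`, remains invariant for `l_t = l + tφ`: for the
components `(l_t)ₙ`, which have parity `n`,
`⟨(l_t)ₙ(v₁, …, vₙ), vₙ₊₁⟩ = (-1)^(n + v₁ n) ⟨v₁, (l_t)ₙ(v₂, …, vₙ₊₁)⟩`. -/
def DeformationPreserves (B : LinearMap.BilinForm K V) (p : ZMod 2) (l φ : Cochain 𝒱) : Prop :=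
  ∀ (n : ℕ) (i : Fin (n + 1) → ZMod 2) (v : Fin (n + 1) → V), 1 ≤ n → (∀ k, v k ∈ 𝒱 (i k)) →
    bilT p (parityOp 𝒱) B
        (component 𝒱 (defCochain 𝒱 p l φ) (fun k => i (Fin.castSucc k))
          (fun k => v (Fin.castSucc k)))
        (v (Fin.last n), 0) =
      sgn K ((n : ZMod 2) + i 0 * n) •
        bilT p (parityOp 𝒱) B (v 0, 0)
          (component 𝒱 (defCochain 𝒱 p l φ) (fun k => i (Fin.succ k)) (fun k => v (Fin.succ k)))

/-- The infinitesimal deformations `l + tφ` of `l`, with `t` of parity `p`, that preserve the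
inner product. -/
abbrev Deformation (B : LinearMap.BilinForm K V) (l : Cochain 𝒱) (p : ZMod 2) : Type _ :=
  {φ : Cochain 𝒱 // IsDeformation 𝒱 p l φ ∧ DeformationPreserves 𝒱 B p l φ}

/-- `F` is an automorphism of the coalgebra `⊙W[t]` over `K[t]` (even, `t`-linear, compatible with
the diagonal) that is the identity modulo `t`. Compatibility with the diagonal reads
`Δ(F x) = ∑ F x' ⊗ F x''` in `(⊙W ⊗ ⊙W)[t]`, where `Δ x = ∑ x' ⊗ x''`; by `t`-linearity it is
enough to say so for `x` in `⊙W`. -/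
structure IsCoalgAut (p : ZMod 2)
    (F : (RSym (rev 𝒱) × RSym (rev 𝒱)) ≃ₗ[K] (RSym (rev 𝒱) × RSym (rev 𝒱))) : Prop where
  even : HasParity (parT p (rPar (rev 𝒱))) (parT p (rPar (rev 𝒱))) 0 F.toLinearMap
  t_linear : ∀ z, F (mulT (K := K) z) = mulT (K := K) (F z)
  id_mod_t : ∀ z, (F z).1 = z.1
  diag : ∀ x : RSym (rev 𝒱),
    (rDiag (rev 𝒱) (F (x, 0)).1, rDiag (rev 𝒱) (F (x, 0)).2) =
      TensorProduct.lift
        ((bilT p (rPar (rev 𝒱)) (TensorProduct.mk K (RSym (rev 𝒱)) (RSym (rev 𝒱)))).compl₁₂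
          (F.toLinearMap ∘ₗ LinearMap.inl K _ _) (F.toLinearMap ∘ₗ LinearMap.inl K _ _))
        (rDiag (rev 𝒱) x)

/-- The graded antisymmetric even form `ω(πa, πb) = (-1)^|a| ⟨a, b⟩` on `W`. -/
def omega (B : LinearMap.BilinForm K V) : V →ₗ[K] V →ₗ[K] K := B ∘ₗ parityOp 𝒱

/-- The composite `⊙W → ⊙W[t] → W[t]` of `F` with the projection: the components
`fₙ : ⊙ⁿW → W[t]` of `F`. -/
def autComponents (F : (RSym (rev 𝒱) × RSym (rev 𝒱)) ≃ₗ[K] (RSym (rev 𝒱) × RSym (rev 𝒱))) :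
    RSym (rev 𝒱) →ₗ[K] V × V :=
  LinearMap.prodMap (degOne (rev 𝒱) ∘ₗ incl (rev 𝒱)) (degOne (rev 𝒱) ∘ₗ incl (rev 𝒱)) ∘ₗ
    F.toLinearMap ∘ₗ LinearMap.inl K _ _

/-- A coalgebra automorphism `F` with components `f` preserves the inner product if the form `ω`
is invariant under `F`, regarded as a formal change of coordinates on `W` (`F^* ω = ω`):
for all `x = w₁ ⊙ ⋯ ⊙ wₘ`, `m ≥ 0`, and `u, w` in `W`,
`∑ (-1)^(|u||x''|) ω(f(x' ⊙ u), f(x'' ⊙ w)) = ω(u, w)` if `m = 0`, and `= 0` if `m > 0`,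
where `∑ x' ⊗ x''` is the full coproduct of `x`, including `1 ⊗ x` and `x ⊗ 1`.
If only the linear component `ρ` of `F` is nonzero this says that `⟨ρ v, ρ v'⟩ = ⟨v, v'⟩`. -/
def AutPreserves (B : LinearMap.BilinForm K V) (p : ZMod 2)
    (F : (RSym (rev 𝒱) × RSym (rev 𝒱)) ≃ₗ[K] (RSym (rev 𝒱) × RSym (rev 𝒱))) : Prop :=
  ∀ (x : Sym (rev 𝒱)) (i : ZMod 2) (u w : V), u ∈ rev 𝒱 i →
    TensorProduct.lift
      ((bilT p (parityOp (rev 𝒱)) (omega 𝒱 B)).compl₁₂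
        (autComponents 𝒱 F ∘ₗ red (rev 𝒱) ∘ₗ LinearMap.mulRight K (inc (rev 𝒱) u))
        (autComponents 𝒱 F ∘ₗ red (rev 𝒱) ∘ₗ LinearMap.mulRight K (inc (rev 𝒱) w) ∘ₗ
          tw i (symPar (rev 𝒱)).toLinearMap))
      (coprod (rev 𝒱) x) = (aug (rev 𝒱) x * omega 𝒱 B u w, 0)

/-- Two infinitesimal deformations `l + tφ` and `l + tψ` are equivalent, with the inner product
preserved: an automorphism of the coalgebra `⊙W[t]` that is the identity modulo `t` and preserves
the inner product takes the first codifferential to the second. -/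
def Equivalent (B : LinearMap.BilinForm K V) (p : ZMod 2) (l φ ψ : Cochain 𝒱) : Prop :=
  ∃ F : (RSym (rev 𝒱) × RSym (rev 𝒱)) ≃ₗ[K] (RSym (rev 𝒱) × RSym (rev 𝒱)),
    IsCoalgAut 𝒱 p F ∧ AutPreserves 𝒱 B p F ∧
      F.toLinearMap ∘ₗ defOp 𝒱 p l φ = defOp 𝒱 p l ψ ∘ₗ F.toLinearMap

end Cochains

end LInf

end

open LInf

/-!
On the full symmetric coalgebra, left multiplication by a vector `w` is itself a coderivation, and
graded commutators of coderivations are coderivations. For the extension `φ̂` of a map `φ` the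
commutator with `w · ` is the extension of `x ↦ φ(w ⊙ x)`. In characteristic `0` a primitive element
has degree one, because the Euler operator has positive integer eigenvalues on the reduced part;
hence coderivations are determined by their components, and `[φ̂, ψ̂]` is the extension of the
bracket `[φ, ψ]`. This gives `D² = 0` and turns `(l̂ + tφ̂)² = 0` into `Dφ = 0`.

In terms of `ω`, cyclicity of all `φₙ` says `ω(φ(u ⊙ x), w) = -(-1)^(r|u|) ω(u, φ(x ⊙ w))`. This
identity is preserved by the bracket, and for `γ` of the parity of `t` it is exactly the condition
that `1 + tγ̂` preserves `ω`. Since every automorphism that is the identity modulo `t` has the form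
`1 + tγ̂`, and conjugation by it changes `φ` by `Dγ`, equivalence is congruence modulo
coboundaries.
-/

noncomputable section

namespace LInf

section Signs

variable {K : Type*} [Field K]

theorem eq_zero_or_eq_one (i : ZMod 2) : i = 0 ∨ i = 1 := by
  revert i; decide

@[simp]
theorem sgn_zero : sgn K 0 = 1 := if_pos rfl

@[simp]
theorem sgn_one : sgn K 1 = -1 := if_neg one_ne_zero

theorem sgn_add (i j : ZMod 2) : sgn K (i + j) = sgn K i * sgn K j := by
  obtain rfl | rfl := eq_zero_or_eq_one i <;> obtain rfl | rfl := eq_zero_or_eq_one j <;>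
    simp [CharTwo.add_self_eq_zero]

@[simp]
theorem sgn_mul_self (i : ZMod 2) : sgn K i * sgn K i = 1 := by
  rw [← sgn_add, CharTwo.add_self_eq_zero, sgn_zero]

@[simp]
theorem sgn_mul_sgn_mul_self (i : ZMod 2) (c : K) : sgn K i * (sgn K i * c) = c := by
  rw [← mul_assoc, sgn_mul_self, one_mul]

theorem neg_sgn_mul (i : ZMod 2) (c : K) : -(sgn K i * c) = sgn K (i + 1) * c := by
  simp [sgn_add]

theorem sgn_mul_eq_iff {i : ZMod 2} {c d : K} : sgn K i * c = d ↔ c = sgn K i * d :=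
  ⟨fun h => by rw [← h, sgn_mul_sgn_mul_self], fun h => by rw [h, sgn_mul_sgn_mul_self]⟩

theorem sgn_mul_eq_sgn_mul_iff {i j : ZMod 2} {c d : K} :
    sgn K i * c = sgn K j * d ↔ c = sgn K (i + j) * d := by
  rw [sgn_mul_eq_iff, sgn_add, mul_assoc]

variable {M N R : Type*} [AddCommMonoid M] [Module K M] [AddCommMonoid N] [Module K N]
  [AddCommMonoid R] [Module K R]

@[simp]
theorem sgn_smul_sgn_smul_self (i : ZMod 2) (x : M) : sgn K i • sgn K i • x = x := by
  rw [smul_smul, sgn_mul_self, one_smul]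

theorem sgn_smul_eq_iff {i : ZMod 2} {x y : M} : sgn K i • x = y ↔ x = sgn K i • y :=
  ⟨fun h => by rw [← h, sgn_smul_sgn_smul_self], fun h => by rw [h, sgn_smul_sgn_smul_self]⟩

@[simp]
theorem tw_zero (P : M →ₗ[K] M) : tw 0 P = LinearMap.id := if_pos rfl

@[simp]
theorem tw_one (P : M →ₗ[K] M) : tw 1 P = P := if_neg one_ne_zero

theorem tw_apply_of_apply_eq {P : M →ₗ[K] M} {i : ZMod 2} {x : M} (h : P x = sgn K i • x)
    (j : ZMod 2) : tw j P x = sgn K (j * i) • x := by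
  obtain rfl | rfl := eq_zero_or_eq_one j <;> simp [h]

theorem tw_add {P : M →ₗ[K] M} (hP : Function.Involutive P) (i j : ZMod 2) (x : M) :
    tw (i + j) P x = tw i P (tw j P x) := by
  obtain rfl | rfl := eq_zero_or_eq_one i <;> obtain rfl | rfl := eq_zero_or_eq_one j <;>
    simp [CharTwo.add_self_eq_zero, hP x]

variable {P : M →ₗ[K] M} {Q : N →ₗ[K] N} {S : R →ₗ[K] R} {r s : ZMod 2}

theorem HasParity.apply {f : M →ₗ[K] N} (h : HasParity P Q r f) (x : M) :
    Q (f x) = sgn K r • f (P x) :=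
  LinearMap.congr_fun h x

theorem HasParity.apply_eq {f : M →ₗ[K] N} (h : HasParity P Q r f) {i : ZMod 2} {x : M}
    (hx : P x = sgn K i • x) : Q (f x) = sgn K (r + i) • f x := by
  rw [h.apply, hx, map_smul, smul_smul, sgn_add]

theorem HasParity.tw_apply {f : M →ₗ[K] N} (h : HasParity P Q r f) (i : ZMod 2) (x : M) :
    tw i Q (f x) = sgn K (i * r) • f (tw i P x) := by
  obtain rfl | rfl := eq_zero_or_eq_one i
  · simp
  · simpa using h.apply x

theorem HasParity.comp {f : M →ₗ[K] N} {g : N →ₗ[K] R} (hg : HasParity Q S s g)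
    (hf : HasParity P Q r f) : HasParity P S (s + r) (g ∘ₗ f) := by
  refine LinearMap.ext fun x => ?_
  simp only [LinearMap.comp_apply, LinearMap.smul_apply, hg.apply, hf.apply, map_smul, smul_smul,
    sgn_add]

theorem HasParity.smul {f : M →ₗ[K] N} (hf : HasParity P Q r f) (c : K) :
    HasParity P Q r (c • f) := by
  rw [HasParity, LinearMap.comp_smul, hf, LinearMap.smul_comp, smul_comm]

theorem HasParity.sub {N : Type*} [AddCommGroup N] [Module K N] {Q : N →ₗ[K] N} {f g : M →ₗ[K] N}
    (hf : HasParity P Q r f) (hg : HasParity P Q r g) : HasParity P Q r (f - g) := by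
  rw [HasParity, LinearMap.comp_sub, hf, hg, LinearMap.sub_comp, smul_sub]

end Signs

section GradedSpaces

variable {K : Type*} [Field K] {W : Type*} [AddCommGroup W] [Module K W]
variable (𝒲 : ZMod 2 → Submodule K W) [DirectSum.Decomposition 𝒲]

theorem parityOp_involutive : Function.Involutive (parityOp 𝒲) := fun w => by
  induction w using DirectSum.Decomposition.inductionOn 𝒲 with
  | zero => simp only [map_zero]
  | homogeneous m =>
    rw [parityOp_of_mem 𝒲 m.2, map_smul, parityOp_of_mem 𝒲 m.2, sgn_smul_sgn_smul_self]
  | add a b ha hb => rw [map_add, map_add, ha, hb]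

theorem tw_parityOp_of_mem {i : ZMod 2} {w : W} (hw : w ∈ 𝒲 i) (j : ZMod 2) :
    tw j (parityOp 𝒲) w = sgn K (j * i) • w :=
  tw_apply_of_apply_eq (parityOp_of_mem 𝒲 hw) j

theorem grProj_mem (i : ZMod 2) (w : W) : grProj 𝒲 i w ∈ 𝒲 i := Subtype.mem _

theorem grProj_add_grProj (w : W) : grProj 𝒲 0 w + grProj 𝒲 1 w = w := by
  induction w using DirectSum.Decomposition.inductionOn 𝒲 with
  | zero => simp only [map_zero, add_zero]
  | @homogeneous i m =>
    simp only [grProj_of_mem 𝒲 m.2]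
    obtain rfl | rfl := eq_zero_or_eq_one i <;> simp
  | add a b ha hb => rw [map_add, map_add, add_add_add_comm, ha, hb]

variable {𝒲} in
theorem linearMap_ext_of_mem {N : Type*} [AddCommMonoid N] [Module K N] {f g : W →ₗ[K] N}
    (h : ∀ (i : ZMod 2), ∀ w ∈ 𝒲 i, f w = g w) : f = g :=
  LinearMap.ext fun w => by
    rw [← grProj_add_grProj 𝒲 w, map_add, map_add, h 0 _ (grProj_mem 𝒲 0 w),
      h 1 _ (grProj_mem 𝒲 1 w)]

theorem mem_of_parityOp_eq [NeZero (2 : K)] {i : ZMod 2} {w : W}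
    (h : parityOp 𝒲 w = sgn K i • w) : w ∈ 𝒲 i := by
  have sum : grProj 𝒲 0 w + grProj 𝒲 1 w = w := grProj_add_grProj 𝒲 w
  have diff : grProj 𝒲 0 w - grProj 𝒲 1 w = sgn K i • w := h
  suffices e : (2 : K) • w = (2 : K) • grProj 𝒲 i w by
    rw [smul_right_injective W two_ne_zero e]
    exact grProj_mem 𝒲 i w
  obtain rfl | rfl := eq_zero_or_eq_one i
  · rw [sgn_zero] at diff
    linear_combination (norm := module) -sum - diff
  · rw [sgn_one] at diff
    linear_combination (norm := module) diff - sum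

end GradedSpaces

section GradedOperators

variable {K : Type*} [Field K] {M : Type*} [AddCommGroup M] [Module K M]

/-- The graded commutator `[F, G] = FG - (-1)^(rs) GF` of operators of parities `r` and `s`. -/
def gradedComm (r s : ZMod 2) (F G : M →ₗ[K] M) : M →ₗ[K] M :=
  F ∘ₗ G - sgn K (r * s) • (G ∘ₗ F)

/-- The operator `F ⊗ 1 + 1 ⊗ F` on `M ⊗ M`, for `F` of parity `r`, with the Koszul sign rule:
`x ⊗ y ↦ F x ⊗ y + (-1)^(r|x|) x ⊗ F y`, where `P` is the parity operator of `M`. -/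
def leibniz (P : M →ₗ[K] M) (r : ZMod 2) (F : M →ₗ[K] M) : M ⊗[K] M →ₗ[K] M ⊗[K] M :=
  TensorProduct.map F LinearMap.id + TensorProduct.map (tw r P) F

/-- `D` is a coderivation of parity `r` for the coproduct `Δ` of `M`, where `P` is the parity
operator of `M`. -/
def IsCoderivation (P : M →ₗ[K] M) (Δ : M →ₗ[K] M ⊗[K] M) (r : ZMod 2) (D : M →ₗ[K] M) : Prop :=
  Δ ∘ₗ D = leibniz P r D ∘ₗ Δ

variable {P : M →ₗ[K] M} {Δ : M →ₗ[K] M ⊗[K] M} {r s : ZMod 2} {F G : M →ₗ[K] M}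

theorem leibniz_tmul (x y : M) : leibniz P r F (x ⊗ₜ y) = F x ⊗ₜ y + tw r P x ⊗ₜ F y := rfl

theorem leibniz_sub : leibniz P r (F - G) = leibniz P r F - leibniz P r G := by
  refine TensorProduct.ext' fun x y => ?_
  simp only [LinearMap.sub_apply, leibniz_tmul, TensorProduct.sub_tmul, TensorProduct.tmul_sub]
  abel

theorem leibniz_gradedComm (hP : Function.Involutive P) (hF : HasParity P P r F)
    (hG : HasParity P P s G) :
    leibniz P (r + s) (gradedComm r s F G) =
      gradedComm r s (leibniz P r F) (leibniz P s G) := by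
  refine TensorProduct.ext' fun x y => ?_
  have rs : tw r P (tw s P x) = tw (r + s) P x := (tw_add hP r s x).symm
  have sr : tw s P (tw r P x) = tw (r + s) P x := by rw [← tw_add hP, add_comm]
  simp only [gradedComm, LinearMap.sub_apply, LinearMap.smul_apply, LinearMap.comp_apply,
    leibniz_tmul, map_add, hF.tw_apply, hG.tw_apply, rs, sr, TensorProduct.sub_tmul,
    TensorProduct.tmul_sub, TensorProduct.smul_tmul', TensorProduct.tmul_smul, smul_add,
    mul_comm s r, sgn_smul_sgn_smul_self]
  abel

theorem HasParity.gradedComm (hF : HasParity P P r F) (hG : HasParity P P s G) :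
    HasParity P P (r + s) (gradedComm r s F G) :=
  (hF.comp hG).sub (by simpa only [add_comm s r] using (hG.comp hF).smul (sgn K (r * s)))

theorem IsCoderivation.apply (hF : IsCoderivation P Δ r F) (x : M) :
    Δ (F x) = leibniz P r F (Δ x) :=
  LinearMap.congr_fun hF x

theorem IsCoderivation.sub (hF : IsCoderivation P Δ r F) (hG : IsCoderivation P Δ r G) :
    IsCoderivation P Δ r (F - G) := by
  rw [IsCoderivation, LinearMap.comp_sub, hF, hG, leibniz_sub, LinearMap.sub_comp]

theorem IsCoderivation.gradedComm (hP : Function.Involutive P) (hF : HasParity P P r F)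
    (hG : HasParity P P s G) (hF' : IsCoderivation P Δ r F) (hG' : IsCoderivation P Δ s G) :
    IsCoderivation P Δ (r + s) (gradedComm r s F G) := by
  refine LinearMap.ext fun x => ?_
  rw [leibniz_gradedComm hP hF hG]
  simp only [LInf.gradedComm, LinearMap.comp_apply, LinearMap.sub_apply, LinearMap.smul_apply,
    map_sub, map_smul, hF'.apply, hG'.apply]

end GradedOperators

section Symmetric

variable {K : Type*} [Field K] {W : Type*} [AddCommGroup W] [Module K W]
variable (𝒲 : ZMod 2 → Submodule K W)

@[simp]
theorem aug_inc (w : W) : aug 𝒲 (inc 𝒲 w) = 0 := by simp [aug]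

@[simp]
theorem degOne_one : degOne 𝒲 1 = 0 := by simp [degOne]

variable [DirectSum.Decomposition 𝒲]

variable {𝒲} in
@[elab_as_elim]
theorem sym_induction {p : Sym 𝒲 → Prop} (one : p 1)
    (inc_mul : ∀ (i : ZMod 2) (w : W) (x : Sym 𝒲), w ∈ 𝒲 i → p x → p (inc 𝒲 w * x))
    (add : ∀ x y, p x → p y → p (x + y)) (smul : ∀ (c : K) x, p x → p (c • x))
    (x : Sym 𝒲) : p x := by
  obtain ⟨t, rfl⟩ : ∃ t, symMk 𝒲 t = x := RingQuot.mkAlgHom_surjective K _ x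
  suffices h : ∀ x, p x → p (symMk 𝒲 t * x) by simpa using h 1 one
  induction t using TensorAlgebra.induction with
  | algebraMap c =>
    intro x hx
    rw [AlgHom.commutes, ← Algebra.smul_def]
    exact smul c x hx
  | ι w =>
    intro x hx
    change p (inc 𝒲 w * x)
    rw [← grProj_add_grProj 𝒲 w, map_add, add_mul]
    exact add _ _ (inc_mul 0 _ x (grProj_mem 𝒲 0 w) hx) (inc_mul 1 _ x (grProj_mem 𝒲 1 w) hx)
  | mul a b ha hb =>
    intro x hx
    rw [map_mul, mul_assoc]
    exact ha _ (hb _ hx)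
  | add a b ha hb =>
    intro x hx
    rw [map_add, add_mul]
    exact add _ _ (ha _ hx) (hb _ hx)

variable {𝒲} in
theorem sym_linearMap_ext {N : Type*} [AddCommMonoid N] [Module K N] {f g : Sym 𝒲 →ₗ[K] N}
    (one : f 1 = g 1)
    (inc_mul : ∀ (i : ZMod 2) (w : W) (x : Sym 𝒲), w ∈ 𝒲 i → f x = g x →
      f (inc 𝒲 w * x) = g (inc 𝒲 w * x)) : f = g := by
  refine LinearMap.ext fun x => ?_
  induction x using sym_induction with
  | one => exact one
  | inc_mul i w x hw hx => exact inc_mul i w x hw hx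
  | add x y hx hy => rw [map_add, map_add, hx, hy]
  | smul c x hx => rw [map_smul, map_smul, hx]

theorem degOneAux_apply_fst (x : Sym 𝒲) : (degOneAux 𝒲 x (1, 0)).1 = aug 𝒲 x := by
  induction x using sym_induction with
  | one => simp
  | inc_mul => simp [degOneAux]
  | add x y hx hy => simp [hx, hy]
  | smul c x hx => simp [hx]

@[simp]
theorem degOne_inc_mul (w : W) (x : Sym 𝒲) : degOne 𝒲 (inc 𝒲 w * x) = aug 𝒲 x • w := by
  rw [← degOneAux_apply_fst]
  simp [degOne, degOneAux]

@[simp]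
theorem degOne_inc (w : W) : degOne 𝒲 (inc 𝒲 w) = w := by
  simpa using degOne_inc_mul 𝒲 w 1

@[simp]
theorem symPar_inc (w : W) : symPar 𝒲 (inc 𝒲 w) = inc 𝒲 (parityOp 𝒲 w) := by
  simp [symPar]

theorem symPar_involutive : Function.Involutive (symPar 𝒲).toLinearMap := fun x => by
  induction x using sym_induction with
  | one => simp
  | inc_mul _ w x _ hx =>
    rw [AlgHom.toLinearMap_apply, AlgHom.toLinearMap_apply] at hx ⊢
    rw [map_mul, map_mul, hx, symPar_inc, symPar_inc, parityOp_involutive]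
  | add x y hx hy => rw [map_add, map_add, hx, hy]
  | smul c x hx => rw [map_smul, map_smul, hx]

/-- The operator `x ↦ (-1)^(i|x|) x` on the symmetric algebra. -/
abbrev symTw (i : ZMod 2) : Sym 𝒲 →ₗ[K] Sym 𝒲 := tw i (symPar 𝒲).toLinearMap

@[simp]
theorem symTw_one (i : ZMod 2) : symTw 𝒲 i 1 = 1 := by
  obtain rfl | rfl := eq_zero_or_eq_one i <;> simp

theorem symTw_mul (i : ZMod 2) (x y : Sym 𝒲) :
    symTw 𝒲 i (x * y) = symTw 𝒲 i x * symTw 𝒲 i y := by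
  obtain rfl | rfl := eq_zero_or_eq_one i <;> simp

theorem symTw_inc (i : ZMod 2) (w : W) :
    symTw 𝒲 i (inc 𝒲 w) = inc 𝒲 (tw i (parityOp 𝒲) w) := by
  obtain rfl | rfl := eq_zero_or_eq_one i <;> simp

theorem symTw_inc_mul {i : ZMod 2} {w : W} (hw : w ∈ 𝒲 i) (j : ZMod 2) (x : Sym 𝒲) :
    symTw 𝒲 j (inc 𝒲 w * x) = sgn K (j * i) • (inc 𝒲 w * symTw 𝒲 j x) := by
  rw [symTw_mul, symTw_inc, tw_parityOp_of_mem 𝒲 hw, map_smul, smul_mul_assoc]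

@[simp]
theorem aug_symTw (i : ZMod 2) (x : Sym 𝒲) : aug 𝒲 (symTw 𝒲 i x) = aug 𝒲 x := by
  induction x using sym_induction with
  | one => simp
  | inc_mul => simp [symTw_mul, symTw_inc]
  | add x y hx hy => simp only [map_add, hx, hy]
  | smul c x hx => simp only [map_smul, hx]

theorem mul_inc {i : ZMod 2} {w : W} (hw : w ∈ 𝒲 i) (x : Sym 𝒲) :
    x * inc 𝒲 w = inc 𝒲 w * symTw 𝒲 i x := by
  induction x using sym_induction with
  | one => simp
  | inc_mul j v x hv hx =>
    rw [symTw_inc_mul 𝒲 hv, mul_smul_comm, ← mul_assoc, inc_mul_inc 𝒲 hw hv, smul_mul_assoc,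
      sgn_smul_sgn_smul_self, mul_assoc, hx, mul_assoc]
  | add x y hx hy => rw [add_mul, map_add, mul_add, hx, hy]
  | smul c x hx => rw [smul_mul_assoc, map_smul, mul_smul_comm, hx]

@[simp]
theorem degOne_mul_inc (x : Sym 𝒲) (w : W) : degOne 𝒲 (x * inc 𝒲 w) = aug 𝒲 x • w := by
  suffices h : degOne 𝒲 ∘ₗ LinearMap.mulLeft K x ∘ₗ inc 𝒲 =
      aug 𝒲 x • LinearMap.id from LinearMap.congr_fun h w
  refine linearMap_ext_of_mem (𝒲 := 𝒲) fun i w hw => ?_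
  simp [mul_inc 𝒲 hw]

theorem hasParity_mulLeft_inc {i : ZMod 2} {w : W} (hw : w ∈ 𝒲 i) :
    HasParity (symPar 𝒲).toLinearMap (symPar 𝒲).toLinearMap i
      (LinearMap.mulLeft K (inc 𝒲 w)) :=
  LinearMap.ext (symPar_inc_mul 𝒲 hw)

theorem isCoderivation_mulLeft_inc {i : ZMod 2} {w : W} (hw : w ∈ 𝒲 i) :
    IsCoderivation (symPar 𝒲).toLinearMap (coprod 𝒲) i (LinearMap.mulLeft K (inc 𝒲 w)) := by
  have prim : primMul 𝒲 w = leibniz (symPar 𝒲).toLinearMap i (LinearMap.mulLeft K (inc 𝒲 w)) :=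
    TensorProduct.ext' fun a b => primMul_tmul 𝒲 hw a b
  refine LinearMap.ext fun x => ?_
  rw [LinearMap.comp_apply, LinearMap.mulLeft_apply, coprod_inc_mul, prim, LinearMap.comp_apply]

theorem coprod_inc_mul_of_mem {i : ZMod 2} {w : W} (hw : w ∈ 𝒲 i) (x : Sym 𝒲) :
    coprod 𝒲 (inc 𝒲 w * x) =
      leibniz (symPar 𝒲).toLinearMap i (LinearMap.mulLeft K (inc 𝒲 w)) (coprod 𝒲 x) :=
  (isCoderivation_mulLeft_inc 𝒲 hw).apply x

theorem coprod_inc (w : W) : coprod 𝒲 (inc 𝒲 w) = inc 𝒲 w ⊗ₜ 1 + 1 ⊗ₜ inc 𝒲 w := by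
  suffices h : coprod 𝒲 ∘ₗ inc 𝒲 =
      ((TensorProduct.mk K _ _).flip 1 + TensorProduct.mk K _ _ 1) ∘ₗ inc 𝒲 from
    LinearMap.congr_fun h w
  refine linearMap_ext_of_mem (𝒲 := 𝒲) fun i w hw => ?_
  simpa [coprod_one, leibniz_tmul] using coprod_inc_mul_of_mem 𝒲 hw 1

theorem lTensor_aug_coprod (x : Sym 𝒲) :
    (aug 𝒲).toLinearMap.lTensor (Sym 𝒲) (coprod 𝒲 x) = x ⊗ₜ 1 := by
  suffices h : (aug 𝒲).toLinearMap.lTensor (Sym 𝒲) ∘ₗ coprod 𝒲 =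
      (TensorProduct.mk K _ _).flip 1 from LinearMap.congr_fun h x
  refine sym_linearMap_ext (by simp [coprod_one]) fun i w x hw hx => ?_
  have comm : (aug 𝒲).toLinearMap.lTensor (Sym 𝒲) ∘ₗ
        leibniz (symPar 𝒲).toLinearMap i (LinearMap.mulLeft K (inc 𝒲 w)) =
      (LinearMap.mulLeft K (inc 𝒲 w)).rTensor K ∘ₗ (aug 𝒲).toLinearMap.lTensor (Sym 𝒲) :=
    TensorProduct.ext' fun a b => by simp [leibniz_tmul]
  rw [LinearMap.comp_apply, coprod_inc_mul_of_mem 𝒲 hw]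
  exact (LinearMap.congr_fun comm _).trans (congrArg _ hx)

theorem rTensor_aug_coprod (x : Sym 𝒲) :
    (aug 𝒲).toLinearMap.rTensor (Sym 𝒲) (coprod 𝒲 x) = 1 ⊗ₜ x := by
  suffices h : (aug 𝒲).toLinearMap.rTensor (Sym 𝒲) ∘ₗ coprod 𝒲 =
      TensorProduct.mk K _ _ 1 from LinearMap.congr_fun h x
  refine sym_linearMap_ext (by simp [coprod_one]) fun i w x hw hx => ?_
  have comm : (aug 𝒲).toLinearMap.rTensor (Sym 𝒲) ∘ₗ
        leibniz (symPar 𝒲).toLinearMap i (LinearMap.mulLeft K (inc 𝒲 w)) =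
      (LinearMap.mulLeft K (inc 𝒲 w)).lTensor K ∘ₗ (aug 𝒲).toLinearMap.rTensor (Sym 𝒲) :=
    TensorProduct.ext' fun a b => by simp [leibniz_tmul]
  rw [LinearMap.comp_apply, coprod_inc_mul_of_mem 𝒲 hw]
  exact (LinearMap.congr_fun comm _).trans (congrArg _ hx)

variable {𝒲} in
theorem apply_coprod_of_apply_tmul {N : Type*} [AddCommMonoid N] [Module K N]
    {T : Sym 𝒲 ⊗[K] Sym 𝒲 →ₗ[K] N} {F G : Sym 𝒲 →ₗ[K] N}
    (h : ∀ a b, T (a ⊗ₜ b) = aug 𝒲 b • F a + aug 𝒲 a • G b) (x : Sym 𝒲) :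
    T (coprod 𝒲 x) = F x + G x := by
  have hT : T =
      (TensorProduct.rid K N).toLinearMap ∘ₗ F.rTensor K ∘ₗ (aug 𝒲).toLinearMap.lTensor (Sym 𝒲) +
      (TensorProduct.lid K N).toLinearMap ∘ₗ G.lTensor K ∘ₗ
        (aug 𝒲).toLinearMap.rTensor (Sym 𝒲) :=
    TensorProduct.ext' fun a b => by simp [h]
  rw [hT]
  simp only [LinearMap.add_apply, LinearMap.comp_apply, lTensor_aug_coprod, rTensor_aug_coprod]
  simp

end Symmetric

section Coderivations

variable {K : Type*} [Field K] {W : Type*} [AddCommGroup W] [Module K W]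
variable (𝒲 : ZMod 2 → Submodule K W) [DirectSum.Decomposition 𝒲]

/-- A linear map from the symmetric algebra to `W` is homogeneous of parity `r`. -/
abbrev CochainParity (r : ZMod 2) (φ : Sym 𝒲 →ₗ[K] W) : Prop :=
  HasParity (symPar 𝒲).toLinearMap (parityOp 𝒲) r φ

/-- An operator on the symmetric algebra is homogeneous of parity `r`. -/
abbrev SymParity (r : ZMod 2) (D : Sym 𝒲 →ₗ[K] Sym 𝒲) : Prop :=
  HasParity (symPar 𝒲).toLinearMap (symPar 𝒲).toLinearMap r D

/-- An operator on the symmetric algebra is a coderivation of parity `r`. -/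
abbrev SymCoderivation (r : ZMod 2) (D : Sym 𝒲 →ₗ[K] Sym 𝒲) : Prop :=
  IsCoderivation (symPar 𝒲).toLinearMap (coprod 𝒲) r D

/-- The coderivation `x ↦ ∑ φ(x') ⊙ x''` of the symmetric coalgebra that extends
`φ : Sym → W`, where `∑ x' ⊗ x''` is the coproduct of `x`. -/
def coext (φ : Sym 𝒲 →ₗ[K] W) : Sym 𝒲 →ₗ[K] Sym 𝒲 :=
  LinearMap.mul' K (Sym 𝒲) ∘ₗ TensorProduct.map (inc 𝒲 ∘ₗ φ) LinearMap.id ∘ₗ coprod 𝒲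

/-- The map `x ↦ ∑ (-1)^(r|x'|) x' ⊙ φ(x'')`, where `∑ x' ⊗ x''` is the coproduct of `x`. -/
def coextRight (r : ZMod 2) (φ : Sym 𝒲 →ₗ[K] W) : Sym 𝒲 →ₗ[K] Sym 𝒲 :=
  LinearMap.mul' K (Sym 𝒲) ∘ₗ TensorProduct.map (symTw 𝒲 r) (inc 𝒲 ∘ₗ φ) ∘ₗ coprod 𝒲

variable {𝒲} {r i : ZMod 2} {φ : Sym 𝒲 →ₗ[K] W} {D : Sym 𝒲 →ₗ[K] Sym 𝒲} {w : W}

theorem CochainParity.comp_mulLeft_inc (h : CochainParity 𝒲 r φ) (hw : w ∈ 𝒲 i) :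
    CochainParity 𝒲 (r + i) (φ ∘ₗ LinearMap.mulLeft K (inc 𝒲 w)) :=
  HasParity.comp h (hasParity_mulLeft_inc 𝒲 hw)

theorem cochainParity_degOne : CochainParity 𝒲 0 (degOne 𝒲) := by
  refine sym_linearMap_ext (by simp) fun _ _ x _ _ => ?_
  have h : aug 𝒲 (symPar 𝒲 x) = aug 𝒲 x := by simpa using aug_symTw 𝒲 1 x
  simp [h]

theorem coext_one : coext 𝒲 φ 1 = inc 𝒲 (φ 1) := by
  simp [coext, coprod_one]

theorem gradedComm_coext_mulLeft_inc (h : CochainParity 𝒲 r φ) (hw : w ∈ 𝒲 i) :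
    gradedComm r i (coext 𝒲 φ) (LinearMap.mulLeft K (inc 𝒲 w)) =
      coext 𝒲 (φ ∘ₗ LinearMap.mulLeft K (inc 𝒲 w)) := by
  have key : LinearMap.mul' K (Sym 𝒲) ∘ₗ TensorProduct.map (inc 𝒲 ∘ₗ φ) LinearMap.id ∘ₗ
        leibniz (symPar 𝒲).toLinearMap i (LinearMap.mulLeft K (inc 𝒲 w)) =
      LinearMap.mul' K (Sym 𝒲) ∘ₗ
          TensorProduct.map (inc 𝒲 ∘ₗ φ ∘ₗ LinearMap.mulLeft K (inc 𝒲 w)) LinearMap.id +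
        sgn K (r * i) • (LinearMap.mulLeft K (inc 𝒲 w) ∘ₗ LinearMap.mul' K (Sym 𝒲) ∘ₗ
          TensorProduct.map (inc 𝒲 ∘ₗ φ) LinearMap.id) := by
    refine TensorProduct.ext' fun a b => ?_
    have move : inc 𝒲 (φ (symTw 𝒲 i a)) * inc 𝒲 w =
        sgn K (r * i) • (inc 𝒲 w * inc 𝒲 (φ a)) := by
      rw [mul_inc 𝒲 hw, symTw_inc, h.tw_apply, ← tw_add (symPar_involutive 𝒲),
        CharTwo.add_self_eq_zero, tw_zero, LinearMap.id_apply, map_smul, mul_smul_comm,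
        mul_comm r i]
    simp [leibniz_tmul, ← mul_assoc, move]
  refine LinearMap.ext fun x => ?_
  simp only [gradedComm, LinearMap.sub_apply, LinearMap.smul_apply, LinearMap.comp_apply,
    LinearMap.mulLeft_apply, coext, coprod_inc_mul_of_mem 𝒲 hw, sub_eq_iff_eq_add]
  exact LinearMap.congr_fun key (coprod 𝒲 x)

theorem coext_inc_mul (h : CochainParity 𝒲 r φ) (hw : w ∈ 𝒲 i) (x : Sym 𝒲) :
    coext 𝒲 φ (inc 𝒲 w * x) = coext 𝒲 (φ ∘ₗ LinearMap.mulLeft K (inc 𝒲 w)) x +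
      sgn K (r * i) • (inc 𝒲 w * coext 𝒲 φ x) :=
  sub_eq_iff_eq_add.1 (LinearMap.congr_fun (gradedComm_coext_mulLeft_inc h hw) x)

theorem coextRight_inc_mul (hw : w ∈ 𝒲 i) (x : Sym 𝒲) :
    coextRight 𝒲 r φ (inc 𝒲 w * x) =
      coextRight 𝒲 (r + i) (φ ∘ₗ LinearMap.mulLeft K (inc 𝒲 w)) x +
        sgn K (r * i) • (inc 𝒲 w * coextRight 𝒲 r φ x) := by
  have key : LinearMap.mul' K (Sym 𝒲) ∘ₗ TensorProduct.map (symTw 𝒲 r) (inc 𝒲 ∘ₗ φ) ∘ₗ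
        leibniz (symPar 𝒲).toLinearMap i (LinearMap.mulLeft K (inc 𝒲 w)) =
      LinearMap.mul' K (Sym 𝒲) ∘ₗ TensorProduct.map (symTw 𝒲 (r + i))
          (inc 𝒲 ∘ₗ φ ∘ₗ LinearMap.mulLeft K (inc 𝒲 w)) +
        sgn K (r * i) • (LinearMap.mulLeft K (inc 𝒲 w) ∘ₗ LinearMap.mul' K (Sym 𝒲) ∘ₗ
          TensorProduct.map (symTw 𝒲 r) (inc 𝒲 ∘ₗ φ)) := by
    refine TensorProduct.ext' fun a b => ?_
    simp [leibniz_tmul, symTw_inc_mul 𝒲 hw, tw_add (symPar_involutive 𝒲), mul_assoc, add_comm]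
  simp only [coextRight, LinearMap.comp_apply, coprod_inc_mul_of_mem 𝒲 hw]
  exact LinearMap.congr_fun key (coprod 𝒲 x)

theorem coext_mul_inc (h : CochainParity 𝒲 r φ) (w : W) (x : Sym 𝒲) :
    coext 𝒲 φ (x * inc 𝒲 w) = coext 𝒲 φ x * inc 𝒲 w +
      coextRight 𝒲 r (φ ∘ₗ LinearMap.mulRight K (inc 𝒲 w)) x := by
  induction x using sym_induction generalizing r φ with
  | one => simp [coext, coextRight, coprod_one, coprod_inc, add_comm]
  | inc_mul i v x hv ih =>
    have comm : (φ ∘ₗ LinearMap.mulLeft K (inc 𝒲 v)) ∘ₗ LinearMap.mulRight K (inc 𝒲 w) =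
        (φ ∘ₗ LinearMap.mulRight K (inc 𝒲 w)) ∘ₗ LinearMap.mulLeft K (inc 𝒲 v) :=
      LinearMap.ext fun y => by simp [mul_assoc]
    rw [mul_assoc, coext_inc_mul h hv, ih h, ih (h.comp_mulLeft_inc hv), coext_inc_mul h hv,
      coextRight_inc_mul hv, comm, mul_add, add_mul, smul_add, smul_mul_assoc, mul_assoc]
    abel
  | add x y hx hy =>
    simp only [add_mul, map_add, hx h, hy h]
    abel
  | smul c x hx => simp only [smul_mul_assoc, map_smul, hx h, smul_add]

theorem symParity_coext (h : CochainParity 𝒲 r φ) : SymParity 𝒲 r (coext 𝒲 φ) := by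
  refine LinearMap.ext fun x => ?_
  induction x using sym_induction generalizing r φ with
  | one =>
    have h1 := h.apply 1
    simp only [AlgHom.toLinearMap_apply, map_one] at h1
    simp [coext_one, h1]
  | inc_mul i w x hw ih =>
    have h1 := ih (h.comp_mulLeft_inc hw)
    have h2 := ih h
    simp only [LinearMap.comp_apply, LinearMap.smul_apply, AlgHom.toLinearMap_apply] at h1 h2 ⊢
    rw [coext_inc_mul h hw, map_add, h1, map_smul, symPar_inc_mul 𝒲 hw, h2, symPar_inc_mul 𝒲 hw,
      map_smul, coext_inc_mul h hw, sgn_add]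
    simp only [smul_add, smul_smul, mul_smul_comm]
    congr 2
    ring
  | add x y hx hy => rw [map_add, map_add, hx h, hy h]
  | smul c x hx => rw [map_smul, map_smul, hx h]

theorem symCoderivation_coext (h : CochainParity 𝒲 r φ) : SymCoderivation 𝒲 r (coext 𝒲 φ) := by
  refine LinearMap.ext fun x => ?_
  simp only [LinearMap.comp_apply]
  induction x using sym_induction generalizing r φ with
  | one =>
    rw [coext_one, coprod_inc, coprod_one, leibniz_tmul, symTw_one, coext_one]
  | inc_mul i w x hw ih =>
    have comm := leibniz_gradedComm (symPar_involutive 𝒲) (symParity_coext h)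
      (hasParity_mulLeft_inc 𝒲 hw)
    rw [gradedComm_coext_mulLeft_inc h hw] at comm
    rw [coext_inc_mul h hw, map_add, map_smul, coprod_inc_mul_of_mem 𝒲 hw, ih h,
      ih (h.comp_mulLeft_inc hw), coprod_inc_mul_of_mem 𝒲 hw, comm]
    simp [gradedComm]
  | add x y hx hy => simp only [map_add, hx h, hy h]
  | smul c x hx => simp only [map_smul, hx h]

theorem aug_coext (φ : Sym 𝒲 →ₗ[K] W) (x : Sym 𝒲) : aug 𝒲 (coext 𝒲 φ x) = 0 := by
  have h : (aug 𝒲).toLinearMap ∘ₗ LinearMap.mul' K (Sym 𝒲) ∘ₗ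
      TensorProduct.map (inc 𝒲 ∘ₗ φ) LinearMap.id = 0 :=
    TensorProduct.ext' fun a b => by simp
  exact LinearMap.congr_fun h (coprod 𝒲 x)

theorem degOne_coext (φ : Sym 𝒲 →ₗ[K] W) (x : Sym 𝒲) : degOne 𝒲 (coext 𝒲 φ x) = φ x := by
  have key := apply_coprod_of_apply_tmul (𝒲 := 𝒲) (F := φ) (G := 0)
    (T := degOne 𝒲 ∘ₗ LinearMap.mul' K (Sym 𝒲) ∘ₗ TensorProduct.map (inc 𝒲 ∘ₗ φ) LinearMap.id)
    (fun a b => by simp) x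
  simpa [coext] using key

theorem aug_mul_aug_coprod (x : Sym 𝒲) :
    LinearMap.mul' K K (TensorProduct.map (aug 𝒲).toLinearMap (aug 𝒲).toLinearMap (coprod 𝒲 x)) =
      aug 𝒲 x := by
  have key := apply_coprod_of_apply_tmul (𝒲 := 𝒲) (F := (aug 𝒲).toLinearMap) (G := 0)
    (T := LinearMap.mul' K K ∘ₗ TensorProduct.map (aug 𝒲).toLinearMap (aug 𝒲).toLinearMap)
    (fun a b => by simp [mul_comm]) x
  simpa using key

theorem SymCoderivation.aug_apply (h : SymCoderivation 𝒲 r D) (x : Sym 𝒲) :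
    aug 𝒲 (D x) = 0 := by
  have key := apply_coprod_of_apply_tmul (𝒲 := 𝒲) (F := (aug 𝒲).toLinearMap ∘ₗ D)
    (G := (aug 𝒲).toLinearMap ∘ₗ D)
    (T := LinearMap.mul' K K ∘ₗ TensorProduct.map (aug 𝒲).toLinearMap (aug 𝒲).toLinearMap ∘ₗ
      leibniz (symPar 𝒲).toLinearMap r D)
    (fun a b => by simp [leibniz_tmul, mul_comm]) x
  simp only [LinearMap.comp_apply, AlgHom.toLinearMap_apply] at key
  rw [← IsCoderivation.apply h, aug_mul_aug_coprod] at key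
  exact left_eq_add.1 key

end Coderivations

section Euler

variable {K : Type*} [Field K] {W : Type*} [AddCommGroup W] [Module K W]
variable (𝒲 : ZMod 2 → Submodule K W) [DirectSum.Decomposition 𝒲]

/-- The Euler operator, which multiplies a product of `n` elements of `W` by `n`. -/
def euler : Module.End K (Sym 𝒲) := coext 𝒲 (degOne 𝒲)

theorem euler_one : euler 𝒲 1 = 0 := by simp [euler, coext_one]

variable {𝒲} in
theorem euler_inc_mul_of_mem {i : ZMod 2} {w : W} (hw : w ∈ 𝒲 i) (x : Sym 𝒲) :
    euler 𝒲 (inc 𝒲 w * x) = inc 𝒲 w * x + inc 𝒲 w * euler 𝒲 x := by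
  have key := apply_coprod_of_apply_tmul (𝒲 := 𝒲) (F := 0)
    (G := LinearMap.mulLeft K (inc 𝒲 w))
    (T := LinearMap.mul' K (Sym 𝒲) ∘ₗ
      TensorProduct.map (inc 𝒲 ∘ₗ degOne 𝒲 ∘ₗ LinearMap.mulLeft K (inc 𝒲 w)) LinearMap.id)
    (fun a b => by simp) x
  rw [LinearMap.zero_apply, zero_add] at key
  rw [euler, coext_inc_mul cochainParity_degOne hw, zero_mul, sgn_zero, one_smul]
  exact congrArg (· + _) key

variable {𝒲}

theorem inc_mul_mem_iSup_eigenspace_euler {i : ZMod 2} {w : W} (hw : w ∈ 𝒲 i) {x : Sym 𝒲}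
    (hx : x ∈ ⨆ n : ℕ, (euler 𝒲).eigenspace n) :
    inc 𝒲 w * x ∈ ⨆ n : ℕ, (euler 𝒲).eigenspace ((n + 1 : ℕ) : K) := by
  have le : ⨆ n : ℕ, (euler 𝒲).eigenspace (n : K) ≤
      (⨆ n : ℕ, (euler 𝒲).eigenspace ((n + 1 : ℕ) : K)).comap
        (LinearMap.mulLeft K (inc 𝒲 w)) := by
    refine iSup_le fun n y hy => Submodule.mem_iSup_of_mem n ?_
    rw [Module.End.mem_eigenspace_iff] at hy ⊢
    rw [LinearMap.mulLeft_apply, euler_inc_mul_of_mem hw, hy, mul_smul_comm, Nat.cast_succ,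
      add_smul, one_smul, add_comm]
  exact le hx

theorem sub_aug_mem_iSup_eigenspace_euler (x : Sym 𝒲) :
    x - aug 𝒲 x • 1 ∈ ⨆ n : ℕ, (euler 𝒲).eigenspace ((n + 1 : ℕ) : K) := by
  induction x using sym_induction with
  | one => simp
  | inc_mul i w x hw ih =>
    have one_mem : (1 : Sym 𝒲) ∈ (euler 𝒲).eigenspace ((0 : ℕ) : K) := by
      simp [euler_one]
    have x_mem : x ∈ ⨆ n : ℕ, (euler 𝒲).eigenspace (n : K) := by
      rw [← sub_add_cancel x (aug 𝒲 x • 1)]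
      exact add_mem (iSup_comp_le (fun n : ℕ => (euler 𝒲).eigenspace (n : K)) Nat.succ ih)
        (Submodule.smul_mem _ _ (Submodule.mem_iSup_of_mem 0 one_mem))
    simpa using inc_mul_mem_iSup_eigenspace_euler hw x_mem
  | add x y hx hy =>
    rw [map_add, add_smul, add_sub_add_comm]
    exact add_mem hx hy
  | smul c x hx =>
    rw [map_smul, smul_assoc, ← smul_sub]
    exact Submodule.smul_mem _ c hx

theorem eq_zero_of_euler_eq_zero [CharZero K] {x : Sym 𝒲} (hx : euler 𝒲 x = 0)
    (aug_x : aug 𝒲 x = 0) : x = 0 := by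
  have le : ⨆ n : ℕ, (euler 𝒲).eigenspace ((n + 1 : ℕ) : K) ≤
      ⨆ c ≠ (0 : K), (euler 𝒲).eigenspace c :=
    iSup_le fun n => le_iSup₂_of_le _ (Nat.cast_ne_zero.2 n.succ_ne_zero) le_rfl
  have pos := sub_aug_mem_iSup_eigenspace_euler x
  rw [aug_x, zero_smul, sub_zero] at pos
  exact Submodule.disjoint_def.1 ((euler 𝒲).eigenspaces_iSupIndep 0) x
    (by simpa using hx) (le pos)

end Euler

section Uniqueness

variable {K : Type*} [Field K] {W : Type*} [AddCommGroup W] [Module K W]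
variable {𝒲 : ZMod 2 → Submodule K W} [DirectSum.Decomposition 𝒲]

theorem aug_eq_zero_of_coprod_eq {x : Sym 𝒲} (h : coprod 𝒲 x = x ⊗ₜ 1 + 1 ⊗ₜ x) :
    aug 𝒲 x = 0 := by
  have key := aug_mul_aug_coprod x
  rw [h] at key
  simpa using key

theorem eq_inc_degOne_of_coprod_eq [CharZero K] {x : Sym 𝒲}
    (h : coprod 𝒲 x = x ⊗ₜ 1 + 1 ⊗ₜ x) : x = inc 𝒲 (degOne 𝒲 x) := by
  have euler_x : euler 𝒲 x = inc 𝒲 (degOne 𝒲 x) := by simp [euler, coext, h]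
  have euler_inc : euler 𝒲 (inc 𝒲 (degOne 𝒲 x)) = inc 𝒲 (degOne 𝒲 x) := by
    simp [euler, coext, coprod_inc]
  refine sub_eq_zero.1 (eq_zero_of_euler_eq_zero ?_ ?_)
  · rw [map_sub, euler_x, euler_inc, sub_self]
  · rw [map_sub, aug_inc, aug_eq_zero_of_coprod_eq h, sub_zero]

theorem SymCoderivation.eq_zero [CharZero K] {r : ZMod 2} {D : Sym 𝒲 →ₗ[K] Sym 𝒲}
    (hD : SymCoderivation 𝒲 r D) (par : SymParity 𝒲 r D) (h0 : degOne 𝒲 ∘ₗ D = 0) : D = 0 := by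
  refine LinearMap.ext fun x => ?_
  rw [LinearMap.zero_apply]
  induction x using sym_induction generalizing r D with
  | one =>
    have prim : coprod 𝒲 (D 1) = D 1 ⊗ₜ 1 + 1 ⊗ₜ D 1 := by
      rw [IsCoderivation.apply hD, coprod_one, leibniz_tmul, symTw_one]
    have degOne_zero : degOne 𝒲 (D 1) = 0 := LinearMap.congr_fun h0 1
    rw [eq_inc_degOne_of_coprod_eq prim, degOne_zero, map_zero]
  | inc_mul i w x hw ih =>
    -- `[D, w · ]` is again a coderivation without components, so `D` moves past `w` up to sign.
    have comm_zero : degOne 𝒲 ∘ₗ gradedComm r i D (LinearMap.mulLeft K (inc 𝒲 w)) = 0 := by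
      refine LinearMap.ext fun y => ?_
      have h0' := LinearMap.congr_fun h0 (inc 𝒲 w * y)
      simp only [LinearMap.comp_apply, LinearMap.zero_apply] at h0'
      simp [gradedComm, h0', SymCoderivation.aug_apply hD]
    have comm_x := ih
      (hD.gradedComm (symPar_involutive 𝒲) par (hasParity_mulLeft_inc 𝒲 hw)
        (isCoderivation_mulLeft_inc 𝒲 hw))
      (par.gradedComm (hasParity_mulLeft_inc 𝒲 hw)) comm_zero
    simpa [gradedComm, ih hD par h0] using comm_x
  | add x y hx hy => rw [map_add, hx hD par h0, hy hD par h0, add_zero]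
  | smul c x hx => rw [map_smul, hx hD par h0, smul_zero]

theorem SymCoderivation.eq_coext [CharZero K] {r : ZMod 2} {D : Sym 𝒲 →ₗ[K] Sym 𝒲}
    (hD : SymCoderivation 𝒲 r D) (par : SymParity 𝒲 r D) : D = coext 𝒲 (degOne 𝒲 ∘ₗ D) := by
  have par' : CochainParity 𝒲 r (degOne 𝒲 ∘ₗ D) := by
    simpa using HasParity.comp cochainParity_degOne par
  refine sub_eq_zero.1 (SymCoderivation.eq_zero (hD.sub (symCoderivation_coext par'))
    (par.sub (symParity_coext par')) ?_)
  exact LinearMap.ext fun x => by simp [degOne_coext]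

end Uniqueness

section Reduced

variable {K : Type*} [Field K] {W : Type*} [AddCommGroup W] [Module K W]
variable (𝒲 : ZMod 2 → Submodule K W)

@[simp]
theorem aug_incl (x : RSym 𝒲) : aug 𝒲 (incl 𝒲 x) = 0 := x.2

theorem incl_injective : Function.Injective (incl 𝒲) := Subtype.val_injective

theorem incl_red (x : Sym 𝒲) : incl 𝒲 (red 𝒲 x) = x - aug 𝒲 x • 1 := by
  rw [← Algebra.algebraMap_eq_smul_one]
  rfl

theorem incl_red_of_aug_eq_zero {x : Sym 𝒲} (h : aug 𝒲 x = 0) : incl 𝒲 (red 𝒲 x) = x := by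
  rw [incl_red, h, zero_smul, sub_zero]

theorem eq_smul_one_add_incl (x : Sym 𝒲) : x = aug 𝒲 x • 1 + incl 𝒲 (red 𝒲 x) := by
  rw [incl_red, add_sub_cancel]

@[simp]
theorem red_incl (x : RSym 𝒲) : red 𝒲 (incl 𝒲 x) = x :=
  incl_injective 𝒲 (incl_red_of_aug_eq_zero 𝒲 (aug_incl 𝒲 x))

@[simp]
theorem red_one : red 𝒲 1 = 0 := incl_injective 𝒲 (by simp [incl_red])

variable [DirectSum.Decomposition 𝒲]

theorem red_symPar (x : Sym 𝒲) : red 𝒲 (symPar 𝒲 x) = rPar 𝒲 (red 𝒲 x) := by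
  simp [rPar, incl_red]

theorem incl_rPar (x : RSym 𝒲) : incl 𝒲 (rPar 𝒲 x) = symPar 𝒲 (incl 𝒲 x) :=
  incl_red_of_aug_eq_zero 𝒲 (by simpa using aug_symTw 𝒲 1 (incl 𝒲 x))

theorem rPar_involutive : Function.Involutive (rPar 𝒲) := fun x =>
  incl_injective 𝒲 (by
    rw [incl_rPar, incl_rPar]
    exact symPar_involutive 𝒲 _)

theorem red_symTw (i : ZMod 2) (x : Sym 𝒲) :
    red 𝒲 (symTw 𝒲 i x) = tw i (rPar 𝒲) (red 𝒲 x) := by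
  obtain rfl | rfl := eq_zero_or_eq_one i <;> simp [red_symPar]

theorem incl_tw_rPar (i : ZMod 2) (x : RSym 𝒲) :
    incl 𝒲 (tw i (rPar 𝒲) x) = symTw 𝒲 i (incl 𝒲 x) := by
  obtain rfl | rfl := eq_zero_or_eq_one i <;> simp [incl_rPar]

theorem coprod_incl (x : RSym 𝒲) : coprod 𝒲 (incl 𝒲 x) = incl 𝒲 x ⊗ₜ 1 + 1 ⊗ₜ incl 𝒲 x +
    TensorProduct.map (incl 𝒲) (incl 𝒲) (rDiag 𝒲 x) := by
  let e := (aug 𝒲).toLinearMap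
  let η := Algebra.linearMap K (Sym 𝒲)
  have split : TensorProduct.map (incl 𝒲) (incl 𝒲) ∘ₗ TensorProduct.map (red 𝒲) (red 𝒲) =
      LinearMap.id - η.lTensor (Sym 𝒲) ∘ₗ e.lTensor (Sym 𝒲) -
        η.rTensor (Sym 𝒲) ∘ₗ e.rTensor (Sym 𝒲) +
        η.rTensor (Sym 𝒲) ∘ₗ e.rTensor (Sym 𝒲) ∘ₗ η.lTensor (Sym 𝒲) ∘ₗ e.lTensor (Sym 𝒲) := by
    refine TensorProduct.ext' fun a b => ?_
    simp only [LinearMap.comp_apply, LinearMap.add_apply, LinearMap.sub_apply, LinearMap.id_apply,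
      TensorProduct.map_tmul, LinearMap.lTensor_tmul, LinearMap.rTensor_tmul, incl_red, e, η,
      Algebra.linearMap_apply, Algebra.algebraMap_eq_smul_one, AlgHom.toLinearMap_apply,
      TensorProduct.sub_tmul, TensorProduct.tmul_sub]
    abel
  have key := LinearMap.congr_fun split (coprod 𝒲 (incl 𝒲 x))
  simp only [LinearMap.comp_apply, LinearMap.add_apply, LinearMap.sub_apply, LinearMap.id_apply,
    e, η, lTensor_aug_coprod, rTensor_aug_coprod, LinearMap.lTensor_tmul, LinearMap.rTensor_tmul,
    AlgHom.toLinearMap_apply, aug_incl, map_zero, map_one, Algebra.linearMap_apply,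
    TensorProduct.zero_tmul, add_zero] at key
  rw [rDiag, LinearMap.comp_apply, LinearMap.comp_apply, key]
  abel

variable {𝒲} {r s : ZMod 2} {φ ψ : RSym 𝒲 →ₗ[K] W}

theorem cochainParity_comp_red (h : HasParity (rPar 𝒲) (parityOp 𝒲) r φ) :
    CochainParity 𝒲 r (φ ∘ₗ red 𝒲) := by
  refine LinearMap.ext fun x => ?_
  simp [h.apply, red_symPar]

theorem incl_hat (φ : RSym 𝒲 →ₗ[K] W) (x : RSym 𝒲) :
    incl 𝒲 (hat 𝒲 φ x) = coext 𝒲 (φ ∘ₗ red 𝒲) (incl 𝒲 x) :=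
  incl_red_of_aug_eq_zero 𝒲 (aug_coext (φ ∘ₗ red 𝒲) (incl 𝒲 x))

theorem red_coext (φ : RSym 𝒲 →ₗ[K] W) (x : Sym 𝒲) :
    red 𝒲 (coext 𝒲 (φ ∘ₗ red 𝒲) x) = hat 𝒲 φ (red 𝒲 x) := by
  nth_rewrite 1 [eq_smul_one_add_incl 𝒲 x]
  rw [map_add, map_smul, coext_one, ← incl_hat]
  simp

@[simp]
theorem degOne_incl_hat (φ : RSym 𝒲 →ₗ[K] W) (x : RSym 𝒲) :
    degOne 𝒲 (incl 𝒲 (hat 𝒲 φ x)) = φ x := by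
  rw [incl_hat, degOne_coext, LinearMap.comp_apply, red_incl]

theorem hat_injective : Function.Injective (hat 𝒲) := fun φ ψ h => by
  refine LinearMap.ext fun x => ?_
  rw [← degOne_incl_hat φ x, h, degOne_incl_hat]

theorem hasParity_degOne_incl :
    HasParity (rPar 𝒲) (parityOp 𝒲) 0 (degOne 𝒲 ∘ₗ incl 𝒲) := by
  refine LinearMap.ext fun x => ?_
  simpa [incl_rPar] using cochainParity_degOne.apply (incl 𝒲 x)

theorem hasParity_hat (h : HasParity (rPar 𝒲) (parityOp 𝒲) r φ) :
    HasParity (rPar 𝒲) (rPar 𝒲) r (hat 𝒲 φ) := by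
  refine LinearMap.ext fun x => incl_injective 𝒲 ?_
  simpa [incl_rPar, incl_hat] using
    (symParity_coext (cochainParity_comp_red h)).apply (incl 𝒲 x)

theorem hasParity_of_hat (h : HasParity (rPar 𝒲) (rPar 𝒲) r (hat 𝒲 φ)) :
    HasParity (rPar 𝒲) (parityOp 𝒲) r φ := by
  have eq : φ = (degOne 𝒲 ∘ₗ incl 𝒲) ∘ₗ hat 𝒲 φ := LinearMap.ext fun x => by simp
  rw [eq]
  simpa using hasParity_degOne_incl.comp h

theorem isCoderivation_hat (h : HasParity (rPar 𝒲) (parityOp 𝒲) r φ) :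
    IsCoderivation (rPar 𝒲) (rDiag 𝒲) r (hat 𝒲 φ) := by
  have comm : TensorProduct.map (red 𝒲) (red 𝒲) ∘ₗ
        leibniz (symPar 𝒲).toLinearMap r (coext 𝒲 (φ ∘ₗ red 𝒲)) =
      leibniz (rPar 𝒲) r (hat 𝒲 φ) ∘ₗ TensorProduct.map (red 𝒲) (red 𝒲) :=
    TensorProduct.ext' fun a b => by simp [leibniz_tmul, red_coext, red_symTw]
  refine LinearMap.ext fun x => ?_
  simp only [rDiag, LinearMap.comp_apply]
  rw [incl_hat, (symCoderivation_coext (cochainParity_comp_red h)).apply]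
  exact LinearMap.congr_fun comm _

theorem symCoderivation_incl_comp_red {G : RSym 𝒲 →ₗ[K] RSym 𝒲}
    (h : IsCoderivation (rPar 𝒲) (rDiag 𝒲) r G) : SymCoderivation 𝒲 r (incl 𝒲 ∘ₗ G ∘ₗ red 𝒲) := by
  have comm : leibniz (symPar 𝒲).toLinearMap r (incl 𝒲 ∘ₗ G ∘ₗ red 𝒲) ∘ₗ
        TensorProduct.map (incl 𝒲) (incl 𝒲) =
      TensorProduct.map (incl 𝒲) (incl 𝒲) ∘ₗ leibniz (rPar 𝒲) r G :=
    TensorProduct.ext' fun a b => by simp [leibniz_tmul, incl_tw_rPar]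
  refine LinearMap.ext fun x => ?_
  have comm_x := LinearMap.congr_fun comm (rDiag 𝒲 (red 𝒲 x))
  simp only [LinearMap.comp_apply] at comm_x ⊢
  rw [eq_smul_one_add_incl 𝒲 x]
  simp only [map_add, map_smul, coprod_one, coprod_incl, comm_x, h.apply, leibniz_tmul, symTw_one,
    LinearMap.comp_apply, red_one, red_incl, map_zero]
  simp

theorem IsCoderivation.eq_hat [CharZero K] {G : RSym 𝒲 →ₗ[K] RSym 𝒲}
    (h : IsCoderivation (rPar 𝒲) (rDiag 𝒲) r G) (par : HasParity (rPar 𝒲) (rPar 𝒲) r G) :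
    G = hat 𝒲 (degOne 𝒲 ∘ₗ incl 𝒲 ∘ₗ G) := by
  have par' : SymParity 𝒲 r (incl 𝒲 ∘ₗ G ∘ₗ red 𝒲) :=
    LinearMap.ext fun x => by simp [← incl_rPar, red_symPar, par.apply]
  have key := (symCoderivation_incl_comp_red h).eq_coext par'
  refine LinearMap.ext fun x => incl_injective 𝒲 ?_
  simpa [incl_hat, LinearMap.comp_assoc] using LinearMap.congr_fun key (incl 𝒲 x)

variable (𝒲) in
/-- The bracket `[φ, ψ] = φ ∘ ψ̂ - (-1)^(rs) ψ ∘ φ̂` of cochains of parities `r` and `s`. -/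
def bracket (r s : ZMod 2) (φ ψ : RSym 𝒲 →ₗ[K] W) : RSym 𝒲 →ₗ[K] W :=
  φ ∘ₗ hat 𝒲 ψ - sgn K (r * s) • (ψ ∘ₗ hat 𝒲 φ)

theorem HasParity.bracket (hφ : HasParity (rPar 𝒲) (parityOp 𝒲) r φ)
    (hψ : HasParity (rPar 𝒲) (parityOp 𝒲) s ψ) :
    HasParity (rPar 𝒲) (parityOp 𝒲) (r + s) (bracket 𝒲 r s φ ψ) :=
  (hφ.comp (hasParity_hat hψ)).sub
    (by simpa only [add_comm s r] using (hψ.comp (hasParity_hat hφ)).smul (sgn K (r * s)))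

theorem hat_bracket [CharZero K] (hφ : HasParity (rPar 𝒲) (parityOp 𝒲) r φ)
    (hψ : HasParity (rPar 𝒲) (parityOp 𝒲) s ψ) :
    hat 𝒲 (bracket 𝒲 r s φ ψ) = gradedComm r s (hat 𝒲 φ) (hat 𝒲 ψ) := by
  have par := (hasParity_hat hφ).gradedComm (hasParity_hat hψ)
  have coder := IsCoderivation.gradedComm (rPar_involutive 𝒲) (hasParity_hat hφ)
    (hasParity_hat hψ) (isCoderivation_hat hφ) (isCoderivation_hat hψ)
  rw [coder.eq_hat par]
  congr 1
  exact LinearMap.ext fun x => by simp [bracket, gradedComm]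

end Reduced

section Cyclic

variable {K : Type*} [Field K] {W : Type*} [AddCommGroup W] [Module K W]
variable (𝒲 : ZMod 2 → Submodule K W) [DirectSum.Decomposition 𝒲] (ω : W →ₗ[K] W →ₗ[K] K)

/-- A map `φ` of parity `r` from the symmetric algebra to `W` is cyclic for the form `ω` if
`ω(φ(u ⊙ x), w) = -(-1)^(|u|r) ω(u, φ(x ⊙ w))`. -/
def SymCyclic (r : ZMod 2) (φ : Sym 𝒲 →ₗ[K] W) : Prop :=
  ∀ (i : ZMod 2) (u w : W) (x : Sym 𝒲), u ∈ 𝒲 i →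
    ω (φ (inc 𝒲 u * x)) w = -(sgn K (i * r) * ω u (φ (x * inc 𝒲 w)))

variable {𝒲 ω} {r s i : ZMod 2} {φ ψ : Sym 𝒲 →ₗ[K] W}

theorem SymCyclic.apply (h : SymCyclic 𝒲 ω r φ) (u w : W) (x : Sym 𝒲) :
    ω (φ (inc 𝒲 u * x)) w = -ω (tw r (parityOp 𝒲) u) (φ (x * inc 𝒲 w)) := by
  suffices eq : ω.flip w ∘ₗ φ ∘ₗ LinearMap.mulRight K x ∘ₗ inc 𝒲 =
      -(ω.flip (φ (x * inc 𝒲 w)) ∘ₗ tw r (parityOp 𝒲)) from LinearMap.congr_fun eq u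
  refine linearMap_ext_of_mem (𝒲 := 𝒲) fun i u hu => ?_
  simp [h i u w x hu, tw_parityOp_of_mem 𝒲 hu, mul_comm r i]

theorem SymCyclic.apply_coext_mulLeft_inc (hφ : SymCyclic 𝒲 ω r φ) (hψ : SymCyclic 𝒲 ω s ψ)
    (pψ : CochainParity 𝒲 s ψ) {u : W} (hu : u ∈ 𝒲 i) (w : W) (x : Sym 𝒲) :
    ω (φ (coext 𝒲 (ψ ∘ₗ LinearMap.mulLeft K (inc 𝒲 u)) x)) w =
      sgn K (r * (s + i)) * sgn K (i * s) *
        ω u (ψ (coextRight 𝒲 r (φ ∘ₗ LinearMap.mulRight K (inc 𝒲 w)) x)) := by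
  have key : ω.flip w ∘ₗ φ ∘ₗ LinearMap.mul' K (Sym 𝒲) ∘ₗ
        TensorProduct.map (inc 𝒲 ∘ₗ ψ ∘ₗ LinearMap.mulLeft K (inc 𝒲 u)) LinearMap.id =
      (sgn K (r * (s + i)) * sgn K (i * s)) • (ω u ∘ₗ ψ ∘ₗ LinearMap.mul' K (Sym 𝒲) ∘ₗ
        TensorProduct.map (symTw 𝒲 r) (inc 𝒲 ∘ₗ φ ∘ₗ LinearMap.mulRight K (inc 𝒲 w))) := by
    refine TensorProduct.ext' fun a b => ?_
    have move : tw r (parityOp 𝒲) (ψ (inc 𝒲 u * a)) =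
        sgn K (r * (s + i)) • ψ (inc 𝒲 u * symTw 𝒲 r a) :=
      (pψ.comp_mulLeft_inc hu).tw_apply r a
    simp [hφ.apply, move, hψ i u _ _ hu, mul_assoc]
  exact LinearMap.congr_fun key (coprod 𝒲 x)

theorem SymCyclic.apply_coext (hφ : SymCyclic 𝒲 ω r φ) (hψ : SymCyclic 𝒲 ω s ψ)
    (pφ : CochainParity 𝒲 r φ) (pψ : CochainParity 𝒲 s ψ) {u : W} (hu : u ∈ 𝒲 i) (w : W)
    (x : Sym 𝒲) :
    ω (φ (coext 𝒲 ψ (inc 𝒲 u * x))) w =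
      sgn K (r * (s + i)) * sgn K (i * s) *
        (ω u (ψ (coext 𝒲 φ (x * inc 𝒲 w))) - ω u (ψ (coext 𝒲 φ x * inc 𝒲 w))) -
      sgn K (i * s) * sgn K (i * r) * ω u (φ (coext 𝒲 ψ x * inc 𝒲 w)) := by
  rw [coext_inc_mul pψ hu, coext_mul_inc pφ]
  simp only [map_add, map_smul, LinearMap.add_apply, LinearMap.smul_apply, smul_eq_mul,
    hφ i u w _ hu, hφ.apply_coext_mulLeft_inc hψ pψ hu]
  rw [mul_comm s i]
  ring

theorem SymCyclic.bracket {φ ψ : RSym 𝒲 →ₗ[K] W} (hφ : SymCyclic 𝒲 ω r (φ ∘ₗ red 𝒲))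
    (hψ : SymCyclic 𝒲 ω s (ψ ∘ₗ red 𝒲)) (pφ : HasParity (rPar 𝒲) (parityOp 𝒲) r φ)
    (pψ : HasParity (rPar 𝒲) (parityOp 𝒲) s ψ) :
    SymCyclic 𝒲 ω (r + s) (bracket 𝒲 r s φ ψ ∘ₗ red 𝒲) := by
  intro i u w x hu
  have φψ := hφ.apply_coext hψ (cochainParity_comp_red pφ) (cochainParity_comp_red pψ) hu w x
  have ψφ := hψ.apply_coext hφ (cochainParity_comp_red pψ) (cochainParity_comp_red pφ) hu w x
  simp only [LinearMap.comp_apply, red_coext] at φψ ψφ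
  simp only [LInf.bracket, LinearMap.sub_apply, LinearMap.smul_apply, LinearMap.comp_apply,
    map_sub, map_smul, smul_eq_mul, φψ, ψφ, mul_add, sgn_add, mul_comm s r, mul_comm s i,
    mul_comm r i]
  linear_combination -(sgn K (i * s) * sgn K (i * r) *
    (ω u (φ (hat 𝒲 ψ (red 𝒲 (x * inc 𝒲 w)))) -
      ω u (φ (red 𝒲 (coext 𝒲 (ψ ∘ₗ red 𝒲) x * inc 𝒲 w))))) * sgn_mul_self (K := K) (r * s)

end Cyclic

section Monomials

variable {K : Type*} [Field K] {W : Type*} [AddCommGroup W] [Module K W]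
variable (𝒲 : ZMod 2 → Submodule K W) [DirectSum.Decomposition 𝒲]

/-- The product `w₁ ⊙ ⋯ ⊙ wₘ` in the symmetric algebra. -/
abbrev symProd {m : ℕ} (v : Fin m → W) : Sym 𝒲 := (List.ofFn fun k => inc 𝒲 (v k)).prod

variable {𝒲}

theorem symPar_symProd {m : ℕ} {j : Fin m → ZMod 2} {v : Fin m → W} (h : ∀ k, v k ∈ 𝒲 (j k)) :
    symPar 𝒲 (symProd 𝒲 v) = sgn K (∑ k, j k) • symProd 𝒲 v := by
  induction m with
  | zero => simp [symProd]
  | succ m ih =>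
    rw [symProd, List.ofFn_succ, List.prod_cons, symPar_inc_mul 𝒲 (h 0),
      ih fun k => h k.succ, Fin.sum_univ_succ, sgn_add, mul_smul_comm, smul_smul]

theorem mem_span_symProd (x : Sym 𝒲) : x ∈ Submodule.span K
    {y | ∃ (m : ℕ) (j : Fin m → ZMod 2) (v : Fin m → W),
      (∀ k, v k ∈ 𝒲 (j k)) ∧ symProd 𝒲 v = y} := by
  induction x using sym_induction with
  | one => exact Submodule.subset_span ⟨0, 0, 0, fun k => k.elim0, by simp [symProd]⟩
  | inc_mul i w x hw hx =>
    refine Submodule.mem_comap.1 (Submodule.span_le (p := Submodule.comap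
      (LinearMap.mulLeft K (inc 𝒲 w)) _).2 ?_ hx)
    rintro _ ⟨m, j, v, hv, rfl⟩
    refine Submodule.subset_span ⟨m + 1, Fin.cons i j, Fin.cons w v, ?_, by simp [symProd]⟩
    exact Fin.cases hw hv
  | add x y hx hy => exact add_mem hx hy
  | smul c x hx => exact Submodule.smul_mem _ c hx

theorem linearMap_ext_symProd {N : Type*} [AddCommMonoid N] [Module K N] {f g : Sym 𝒲 →ₗ[K] N}
    (h : ∀ (m : ℕ) (j : Fin m → ZMod 2) (v : Fin m → W), (∀ k, v k ∈ 𝒲 (j k)) →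
      f (symProd 𝒲 v) = g (symProd 𝒲 v)) : f = g := by
  refine LinearMap.ext_on (Submodule.eq_top_iff'.2 mem_span_symProd) ?_
  rintro _ ⟨m, j, v, hv, rfl⟩
  exact h m j v hv

theorem symCyclic_of_symProd {ω : W →ₗ[K] W →ₗ[K] K} {r : ZMod 2} {φ : Sym 𝒲 →ₗ[K] W}
    (h : ∀ (i b : ZMod 2) (u w : W) (m : ℕ) (j : Fin m → ZMod 2) (v : Fin m → W),
      u ∈ 𝒲 i → w ∈ 𝒲 b → (∀ k, v k ∈ 𝒲 (j k)) →
        ω (φ (inc 𝒲 u * symProd 𝒲 v)) w =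
          -(sgn K (i * r) * ω u (φ (symProd 𝒲 v * inc 𝒲 w)))) :
    SymCyclic 𝒲 ω r φ := by
  intro i u w x hu
  suffices eq : ω (φ (inc 𝒲 u * x)) =
      -(sgn K (i * r) • (ω u ∘ₗ φ ∘ₗ LinearMap.mulLeft K x ∘ₗ inc 𝒲)) from
    LinearMap.congr_fun eq w
  refine linearMap_ext_of_mem (𝒲 := 𝒲) fun b w hw => ?_
  suffices eq : ω.flip w ∘ₗ φ ∘ₗ LinearMap.mulLeft K (inc 𝒲 u) =
      -(sgn K (i * r) • (ω u ∘ₗ φ ∘ₗ LinearMap.mulRight K (inc 𝒲 w))) from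
    LinearMap.congr_fun eq x
  exact linearMap_ext_symProd fun m j v hv => h i b u w m j v hu hw hv

end Monomials

section Components

variable {K : Type*} [Field K] {V : Type*} [AddCommGroup V] [Module K V]
variable (𝒱 : ZMod 2 → Submodule K V)

/-- The bilinear form `B` is even: homogeneous elements of different parities are orthogonal. -/
def IsEvenForm (B : LinearMap.BilinForm K V) : Prop :=
  ∀ (i j : ZMod 2) (x y : V), x ∈ 𝒱 i → y ∈ 𝒱 j → i ≠ j → B x y = 0

theorem component_castSucc {X : Type*} [AddCommMonoid X] [Module K X] (φ : RSym (rev 𝒱) →ₗ[K] X)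
    {m : ℕ} (i : Fin (m + 2) → ZMod 2) (v : Fin (m + 2) → V) :
    component 𝒱 φ (fun k => i (Fin.castSucc k)) (fun k => v (Fin.castSucc k)) =
      sgn K (m * i 0 + ∑ k : Fin m, ((m - 1 - (k : ℕ) : ℕ) : ZMod 2) * i k.succ.castSucc) •
        φ (red (rev 𝒱) (inc (rev 𝒱) (v 0) * symProd (rev 𝒱) fun k => v k.succ.castSucc)) := by
  rw [component, Fin.sum_univ_succ, List.ofFn_succ, List.prod_cons]
  simp [Nat.sub_sub, add_comm]

theorem component_succ {X : Type*} [AddCommMonoid X] [Module K X] (φ : RSym (rev 𝒱) →ₗ[K] X)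
    {m : ℕ} (i : Fin (m + 2) → ZMod 2) (v : Fin (m + 2) → V) :
    component 𝒱 φ (fun k => i (Fin.succ k)) (fun k => v (Fin.succ k)) =
      sgn K ((∑ k : Fin m, ((m - 1 - (k : ℕ) : ℕ) : ZMod 2) * i k.succ.castSucc) +
          ∑ k : Fin m, i k.succ.castSucc) •
        φ (red (rev 𝒱) ((symProd (rev 𝒱) fun k => v k.succ.castSucc) *
          inc (rev 𝒱) (v (Fin.last (m + 1))))) := by
  have cast_sub : ∀ k : Fin m,
      ((m - (k : ℕ) : ℕ) : ZMod 2) = ((m - 1 - (k : ℕ) : ℕ) : ZMod 2) + 1 := by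
    intro k
    rw [← Nat.cast_succ]
    congr 1
    omega
  rw [component, List.ofFn_succ', List.concat_eq_append, List.prod_append]
  simp [Fin.sum_univ_castSucc, cast_sub, add_mul, Finset.sum_add_distrib]

variable [DirectSum.Decomposition 𝒱]

variable {𝒱} {B : LinearMap.BilinForm K V} {r : ZMod 2} {φ : Cochain 𝒱}

theorem IsEvenForm.apply_parityOp (hB : IsEvenForm 𝒱 B) (x y : V) :
    B (parityOp 𝒱 x) y = B x (parityOp 𝒱 y) := by
  suffices eq : B ∘ₗ parityOp 𝒱 = B.compl₂ (parityOp 𝒱) from LinearMap.congr_fun₂ eq x y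
  refine linearMap_ext_of_mem (𝒲 := 𝒱) fun i x hx => linearMap_ext_of_mem (𝒲 := 𝒱) fun j y hy => ?_
  rw [LinearMap.comp_apply, LinearMap.compl₂_apply, parityOp_of_mem 𝒱 hx, parityOp_of_mem 𝒱 hy]
  obtain rfl | ne := eq_or_ne i j
  · simp
  · simp [hB i j x y hx hy ne]

theorem omega_apply_of_mem_left {i : ZMod 2} {u : V} (hu : u ∈ 𝒱 i) (y : V) :
    omega 𝒱 B u y = sgn K i * B u y := by
  rw [omega, LinearMap.comp_apply, parityOp_of_mem 𝒱 hu, map_smul, LinearMap.smul_apply,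
    smul_eq_mul]

theorem IsEvenForm.omega_apply_of_mem_right (hB : IsEvenForm 𝒱 B) {i : ZMod 2} {w : V}
    (hw : w ∈ 𝒱 i) (z : V) : omega 𝒱 B z w = sgn K i * B z w := by
  rw [omega, LinearMap.comp_apply, hB.apply_parityOp, parityOp_of_mem 𝒱 hw, map_smul, smul_eq_mul]

-- `S` is the sign exponent that the middle arguments `v₂, …, vₘ₊₁` contribute to `component`, and
-- `T` is the sum of their parities.
theorem IsEvenForm.cyclic_sign_iff (hB : IsEvenForm 𝒱 B) {a b m S T : ZMod 2} {u w y z : V}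
    (hu : u ∈ 𝒱 a) (hw : w ∈ 𝒱 b) (hy : y ∈ 𝒱 (r + (T + m) + b)) :
    sgn K (m * a + S) * B z w =
        sgn K ((m + 1) + a * (r + (m + 1) + 1)) * (sgn K (S + T) * B u y) ↔
      omega 𝒱 B z w = -(sgn K ((a + 1) * r) * omega 𝒱 B u y) := by
  rw [hB.omega_apply_of_mem_right hw, omega_apply_of_mem_left hu, neg_sgn_mul, ← mul_assoc,
    ← mul_assoc, ← sgn_add, ← sgn_add, sgn_mul_eq_sgn_mul_iff, sgn_mul_eq_sgn_mul_iff]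
  -- The signs agree only for the parities for which evenness allows `B u y ≠ 0`.
  by_cases parity : a = r + (T + m) + b
  · have exponents : m * a + S + (m + 1 + a * (r + (m + 1) + 1) + (S + T)) =
        b + ((a + 1) * r + 1 + a) := by
      subst parity
      clear hu hw hy
      revert S T m b r
      decide
    rw [exponents]
  · rw [hB _ _ u y hu hy parity, mul_zero, mul_zero]

theorem cochain_apply_symProd_mul_inc_mem [NeZero (2 : K)]
    (hφ : HasParity (rPar (rev 𝒱)) (parityOp (rev 𝒱)) r φ) {m : ℕ} {j : Fin m → ZMod 2}
    {v : Fin m → V} (hv : ∀ k, v k ∈ 𝒱 (j k)) {b : ZMod 2} {w : V} (hw : w ∈ 𝒱 b) :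
    φ (red (rev 𝒱) (symProd (rev 𝒱) v * inc (rev 𝒱) w)) ∈ 𝒱 (r + (∑ k, j k + m) + b) := by
  have parity_symProd : symPar (rev 𝒱) (symProd (rev 𝒱) v) =
      sgn K (∑ k, j k + m) • symProd (rev 𝒱) v := by
    rw [symPar_symProd fun k => le_rev 𝒱 _ (hv k)]
    simp [Finset.sum_add_distrib]
  have parity : symPar (rev 𝒱) (symProd (rev 𝒱) v * inc (rev 𝒱) w) =
      sgn K (∑ k, j k + m + (b + 1)) • (symProd (rev 𝒱) v * inc (rev 𝒱) w) := by
    rw [map_mul, parity_symProd, symPar_inc, parityOp_of_mem (rev 𝒱) (le_rev 𝒱 b hw), map_smul,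
      smul_mul_smul_comm, ← sgn_add]
  have mem := mem_of_parityOp_eq (rev 𝒱) ((cochainParity_comp_red hφ).apply_eq parity)
  have index : r + (∑ k, j k + m + (b + 1)) + 1 = r + (∑ k, j k + m) + b := by
    rw [← add_assoc, ← add_assoc, add_assoc, CharTwo.add_self_eq_zero, add_zero]
  rwa [rev, index] at mem

theorem component_cyclic_iff [NeZero (2 : K)] (hB : IsEvenForm 𝒱 B)
    (hφ : HasParity (rPar (rev 𝒱)) (parityOp (rev 𝒱)) r φ) {m : ℕ} {i : Fin (m + 2) → ZMod 2}
    {v : Fin (m + 2) → V} (hv : ∀ k, v k ∈ 𝒱 (i k)) :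
    B (component 𝒱 φ (fun k => i (Fin.castSucc k)) (fun k => v (Fin.castSucc k)))
        (v (Fin.last (m + 1))) =
      sgn K (((m + 1 : ℕ) : ZMod 2) + i 0 * (r + (m + 1 : ℕ) + 1)) *
        B (v 0) (component 𝒱 φ (fun k => i (Fin.succ k)) (fun k => v (Fin.succ k))) ↔
    omega 𝒱 B ((φ ∘ₗ red (rev 𝒱)) (inc (rev 𝒱) (v 0) *
        symProd (rev 𝒱) fun k : Fin m => v k.succ.castSucc)) (v (Fin.last (m + 1))) =
      -(sgn K ((i 0 + 1) * r) * omega 𝒱 B (v 0) ((φ ∘ₗ red (rev 𝒱))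
        ((symProd (rev 𝒱) fun k : Fin m => v k.succ.castSucc) *
          inc (rev 𝒱) (v (Fin.last (m + 1)))))) := by
  rw [component_castSucc, component_succ, map_smul, map_smul, LinearMap.smul_apply, smul_eq_mul,
    smul_eq_mul, Nat.cast_succ]
  exact hB.cyclic_sign_iff (hv 0) (hv _)
    (cochain_apply_symProd_mul_inc_mem hφ (fun k => hv k.succ.castSucc) (hv _))

theorem isCyclicCochain_iff [NeZero (2 : K)] (hB : IsEvenForm 𝒱 B)
    (hφ : HasParity (rPar (rev 𝒱)) (parityOp (rev 𝒱)) r φ) :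
    IsCyclicCochain 𝒱 B r φ ↔ SymCyclic (rev 𝒱) (omega 𝒱 B) r (φ ∘ₗ red (rev 𝒱)) := by
  constructor
  · refine fun h => symCyclic_of_symProd fun i b u w m j v hu hw hv => ?_
    have mem : ∀ k, (Fin.cons u (Fin.snoc v w : Fin (m + 1) → V) : Fin (m + 2) → V) k ∈
        𝒱 ((Fin.cons (i + 1) (Fin.snoc (fun k => j k + 1) (b + 1) : Fin (m + 1) → ZMod 2) :
          Fin (m + 2) → ZMod 2) k) :=
      Fin.cases hu (Fin.lastCases (by simpa [rev] using hw) fun k => by simpa [rev] using hv k)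
    have key := (component_cyclic_iff hB hφ mem).1 (h (m + 1) _ _ (Nat.le_add_left 1 m) mem)
    have index : i + 1 + 1 = i := by rw [add_assoc, CharTwo.add_self_eq_zero, add_zero]
    simpa [← Fin.succ_castSucc, ← Fin.succ_last, index] using key
  · intro h n i v hn hv
    obtain ⟨m, rfl⟩ := Nat.exists_eq_add_of_le' hn
    exact (component_cyclic_iff hB hφ hv).2 (h _ _ _ _ (le_rev 𝒱 _ (hv 0)))

theorem mem_CC_iff [NeZero (2 : K)] (hB : IsEvenForm 𝒱 B) : φ ∈ CC 𝒱 B r ↔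
    HasParity (rPar (rev 𝒱)) (parityOp (rev 𝒱)) r φ ∧
      SymCyclic (rev 𝒱) (omega 𝒱 B) r (φ ∘ₗ red (rev 𝒱)) :=
  and_congr_right fun h => isCyclicCochain_iff hB h

end Components

section Deformations

variable {K : Type*} [Field K] {V : Type*} [AddCommGroup V] [Module K V]
variable {𝒱 : ZMod 2 → Submodule K V} {B : LinearMap.BilinForm K V} {l φ ψ : Cochain 𝒱}
variable {r p : ZMod 2}

theorem parT_apply {M : Type*} [AddCommMonoid M] [Module K M] (p : ZMod 2) (P : M →ₗ[K] M)
    (z : M × M) : parT p P z = (P z.1, sgn K p • P z.2) := rfl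

theorem component_prod {X Y : Type*} [AddCommMonoid X] [Module K X] [AddCommMonoid Y] [Module K Y]
    (f : RSym (rev 𝒱) →ₗ[K] X) (g : RSym (rev 𝒱) →ₗ[K] Y) {n : ℕ} (i : Fin n → ZMod 2)
    (v : Fin n → V) :
    component 𝒱 (f.prod g) i v = (component 𝒱 f i v, component 𝒱 g i v) := rfl

theorem component_smul {X : Type*} [AddCommMonoid X] [Module K X] (c : K)
    (f : RSym (rev 𝒱) →ₗ[K] X) {n : ℕ} (i : Fin n → ZMod 2) (v : Fin n → V) :
    component 𝒱 (c • f) i v = c • component 𝒱 f i v := by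
  rw [component, component, LinearMap.smul_apply, smul_comm]

variable [DirectSum.Decomposition 𝒱]

theorem defOp_apply (p : ZMod 2) (l φ : Cochain 𝒱) (z : RSym (rev 𝒱) × RSym (rev 𝒱)) :
    defOp 𝒱 p l φ z = (hat (rev 𝒱) l z.1,
      hat (rev 𝒱) φ z.1 + sgn K p • hat (rev 𝒱) l z.2) := by
  simp [defOp, opT]

theorem cobd_eq_bracket (l φ : Cochain 𝒱) (r : ZMod 2) :
    cobd 𝒱 l r φ = bracket (rev 𝒱) r 1 φ l := by
  rw [bracket, mul_one]
  rfl

theorem hat_cobd [CharZero K] (hl : HasParity (rPar (rev 𝒱)) (parityOp (rev 𝒱)) 1 l)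
    (hφ : HasParity (rPar (rev 𝒱)) (parityOp (rev 𝒱)) r φ) :
    hat (rev 𝒱) (cobd 𝒱 l r φ) =
      hat (rev 𝒱) φ ∘ₗ hat (rev 𝒱) l - sgn K r • (hat (rev 𝒱) l ∘ₗ hat (rev 𝒱) φ) := by
  rw [cobd_eq_bracket, hat_bracket hφ hl, gradedComm, mul_one]

theorem cobd_mem_CC [NeZero (2 : K)] (hB : IsEvenForm 𝒱 B) (hl : l ∈ CC 𝒱 B 1)
    (hφ : φ ∈ CC 𝒱 B r) : cobd 𝒱 l r φ ∈ CC 𝒱 B (r + 1) := by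
  rw [mem_CC_iff hB] at hl hφ ⊢
  rw [cobd_eq_bracket]
  exact ⟨hφ.1.bracket hl.1, hφ.2.bracket hl.2 hφ.1 hl.1⟩

theorem cobd_cobd [CharZero K] (hl : IsLInfty 𝒱 l)
    (hφ : HasParity (rPar (rev 𝒱)) (parityOp (rev 𝒱)) r φ) :
    cobd 𝒱 l (r + 1) (cobd 𝒱 l r φ) = 0 := by
  have par : HasParity (rPar (rev 𝒱)) (parityOp (rev 𝒱)) (r + 1) (cobd 𝒱 l r φ) :=
    cobd_eq_bracket l φ r ▸ hφ.bracket hl.odd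
  have sq_zero : ∀ x, hat (rev 𝒱) l (hat (rev 𝒱) l x) = 0 := LinearMap.congr_fun hl.sq_zero
  refine hat_injective (LinearMap.ext fun x => ?_)
  rw [hat_cobd hl.odd par, hat_cobd hl.odd hφ]
  simp [sq_zero, sgn_add]

theorem coboundaries_le_cocycles [CharZero K] (hB : IsEvenForm 𝒱 B) (hl : IsLInfty 𝒱 l)
    (hinv : IsCyclicCochain 𝒱 B 1 l) (r : ZMod 2) :
    coboundaries 𝒱 B l r ≤ cocycles 𝒱 B l r := by
  rintro _ ⟨φ, hφ, rfl⟩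
  have index : r + 1 + 1 = r := by rw [add_assoc, CharTwo.add_self_eq_zero, add_zero]
  have closed := cobd_cobd hl hφ.1
  have cyclic := cobd_mem_CC hB ⟨hl.odd, hinv⟩ hφ
  rw [index] at closed cyclic
  exact ⟨cyclic, closed⟩

theorem hasParity_defOp_iff (hl : HasParity (rPar (rev 𝒱)) (parityOp (rev 𝒱)) 1 l) :
    HasParity (parT p (rPar (rev 𝒱))) (parT p (rPar (rev 𝒱))) 1 (defOp 𝒱 p l φ) ↔
      HasParity (rPar (rev 𝒱)) (parityOp (rev 𝒱)) (p + 1) φ := by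
  constructor
  · refine fun h => hasParity_of_hat (LinearMap.ext fun x => ?_)
    have coeff := congrArg Prod.snd (h.apply (x, 0))
    simp only [defOp_apply, parT_apply, map_zero, smul_zero, add_zero, Prod.smul_mk] at coeff
    rw [LinearMap.smul_apply, sgn_add, ← smul_smul]
    exact sgn_smul_eq_iff.1 coeff
  · refine fun h => LinearMap.ext fun ⟨x, y⟩ => ?_
    simp only [LinearMap.comp_apply, LinearMap.smul_apply, defOp_apply, parT_apply, map_add,
      map_smul, (hasParity_hat h).apply, (hasParity_hat hl).apply, Prod.smul_mk, sgn_add,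
      ← smul_smul, smul_add, sgn_smul_sgn_smul_self, smul_comm (sgn K p) (sgn K 1)]

theorem defOp_comp_defOp_eq_zero_iff [CharZero K] (hl : IsLInfty 𝒱 l)
    (hφ : HasParity (rPar (rev 𝒱)) (parityOp (rev 𝒱)) (p + 1) φ) :
    defOp 𝒱 p l φ ∘ₗ defOp 𝒱 p l φ = 0 ↔ cobd 𝒱 l (p + 1) φ = 0 := by
  have sq_zero : ∀ x, hat (rev 𝒱) l (hat (rev 𝒱) l x) = 0 := LinearMap.congr_fun hl.sq_zero
  have sq : ∀ z, defOp 𝒱 p l φ (defOp 𝒱 p l φ z) = (0, hat (rev 𝒱) (cobd 𝒱 l (p + 1) φ) z.1) :=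
    fun z => by simp [defOp_apply, hat_cobd hl.odd hφ, sq_zero, sgn_add]
  constructor
  · refine fun h => hat_injective (LinearMap.ext fun x => ?_)
    simpa [sq] using LinearMap.congr_fun h (x, 0)
  · refine fun h => LinearMap.ext fun z => ?_
    simp [sq, h]

theorem isDeformation_iff [CharZero K] (hl : IsLInfty 𝒱 l) : IsDeformation 𝒱 p l φ ↔
    HasParity (rPar (rev 𝒱)) (parityOp (rev 𝒱)) (p + 1) φ ∧ cobd 𝒱 l (p + 1) φ = 0 := by
  rw [← hasParity_defOp_iff hl.odd]
  exact ⟨fun h => ⟨h.odd, (defOp_comp_defOp_eq_zero_iff hl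
      ((hasParity_defOp_iff hl.odd).1 h.odd)).1 h.sq_zero⟩,
    fun h => ⟨h.1, (defOp_comp_defOp_eq_zero_iff hl ((hasParity_defOp_iff hl.odd).1 h.1)).2 h.2⟩⟩

theorem deformationPreserves_iff (hinv : IsCyclicCochain 𝒱 B 1 l) :
    DeformationPreserves 𝒱 B p l φ ↔ IsCyclicCochain 𝒱 B (p + 1) φ := by
  refine forall₅_congr fun n i v hn hv => ?_
  have index : (1 : ZMod 2) + n + 1 = n := by
    rw [add_right_comm, CharTwo.add_self_eq_zero, zero_add]
  have index' : p + 1 + n + 1 = p + n := by rw [add_assoc p 1, add_assoc p, index]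
  have base := hinv n i v hn hv
  rw [index] at base
  rw [defCochain, component_prod, component_prod, component_smul, component_smul, index']
  simp only [bilT, LinearMap.mk₂_apply, Prod.smul_mk, Prod.mk.injEq, map_zero, map_smul,
    LinearMap.smul_apply, LinearMap.zero_apply, add_zero, zero_add, tw_parityOp_of_mem 𝒱 (hv 0),
    smul_eq_mul, base, true_and]
  rw [sgn_mul_eq_iff, ← mul_assoc, ← mul_assoc, ← mul_assoc, ← sgn_add, ← sgn_add, ← sgn_add]
  have exponents : p + (n + i 0 * n) + p + p * i 0 = (n : ZMod 2) + i 0 * (p + n) := by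
    generalize (n : ZMod 2) = m, i 0 = j
    clear hn hv base index index'
    revert p m j
    decide
  rw [exponents]

theorem mem_cocycles_iff [CharZero K] (hl : IsLInfty 𝒱 l) (hinv : IsCyclicCochain 𝒱 B 1 l) :
    φ ∈ cocycles 𝒱 B l (p + 1) ↔ IsDeformation 𝒱 p l φ ∧ DeformationPreserves 𝒱 B p l φ := by
  rw [isDeformation_iff hl, deformationPreserves_iff hinv, and_right_comm]
  rfl

end Deformations

section Automorphisms

variable {K : Type*} [Field K] {V : Type*} [AddCommGroup V] [Module K V]
variable {𝒱 : ZMod 2 → Submodule K V} [DirectSum.Decomposition 𝒱]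
variable {B : LinearMap.BilinForm K V} {l φ ψ γ : Cochain 𝒱} {p : ZMod 2}

/-- The automorphism `1 + tG` of `M[t]`, `x + t y ↦ x + t (y + G x)`. -/
def oneAddT {M : Type*} [AddCommGroup M] [Module K M] (G : M →ₗ[K] M) :
    (M × M) ≃ₗ[K] (M × M) :=
  (LinearEquiv.refl K M).skewProd (LinearEquiv.refl K M) G

@[simp]
theorem oneAddT_apply {M : Type*} [AddCommGroup M] [Module K M] (G : M →ₗ[K] M) (z : M × M) :
    oneAddT G z = (z.1, z.2 + G z.1) := rfl

theorem exists_eq_oneAddT {M : Type*} [AddCommGroup M] [Module K M] {F : (M × M) ≃ₗ[K] (M × M)}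
    (t_linear : ∀ z, F (mulT (K := K) z) = mulT (K := K) (F z)) (id_mod_t : ∀ z, (F z).1 = z.1) :
    ∃ G : M →ₗ[K] M, F = oneAddT G := by
  refine ⟨LinearMap.snd K _ _ ∘ₗ F.toLinearMap ∘ₗ LinearMap.inl K _ _, LinearEquiv.ext fun z => ?_⟩
  have decomp : z = (z.1, 0) + mulT (K := K) (z.2, 0) := by simp [mulT]
  have apply_decomp : F z = F (z.1, 0) + mulT (K := K) (F (z.2, 0)) := by
    rw [← t_linear, ← map_add, ← decomp]
  rw [apply_decomp]
  ext <;> simp [mulT, id_mod_t, add_comm]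

theorem isCoalgAut_oneAddT_iff {G : RSym (rev 𝒱) →ₗ[K] RSym (rev 𝒱)} :
    IsCoalgAut 𝒱 p (oneAddT G) ↔ HasParity (rPar (rev 𝒱)) (rPar (rev 𝒱)) p G ∧
      IsCoderivation (rPar (rev 𝒱)) (rDiag (rev 𝒱)) p G := by
  have diag : TensorProduct.lift
        ((bilT p (rPar (rev 𝒱)) (TensorProduct.mk K (RSym (rev 𝒱)) (RSym (rev 𝒱)))).compl₁₂
          ((oneAddT G).toLinearMap ∘ₗ LinearMap.inl K _ _)
          ((oneAddT G).toLinearMap ∘ₗ LinearMap.inl K _ _)) =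
      LinearMap.prod LinearMap.id (leibniz (rPar (rev 𝒱)) p G) :=
    TensorProduct.ext' fun a b => by simp [bilT, leibniz_tmul]
  constructor
  · refine fun h => ⟨LinearMap.ext fun x => ?_, LinearMap.ext fun x => ?_⟩
    · have even := congrArg Prod.snd (h.even.apply (x, 0))
      simp only [LinearEquiv.coe_coe, oneAddT_apply, parT_apply, map_zero, smul_zero, zero_add,
        sgn_zero, one_smul] at even
      exact sgn_smul_eq_iff.1 even
    · simpa [diag] using congrArg Prod.snd (h.diag x)
  · rintro ⟨par, coder⟩
    refine ⟨LinearMap.ext fun z => ?_, fun z => by simp [mulT], fun z => rfl, fun x => ?_⟩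
    · simp [parT_apply, par.apply]
    · simp [diag, coder.apply]

theorem isCoalgAut_oneAddT_iff_exists_hat [CharZero K]
    {G : RSym (rev 𝒱) →ₗ[K] RSym (rev 𝒱)} :
    IsCoalgAut 𝒱 p (oneAddT G) ↔ ∃ γ : Cochain 𝒱,
      HasParity (rPar (rev 𝒱)) (parityOp (rev 𝒱)) p γ ∧ G = hat (rev 𝒱) γ := by
  rw [isCoalgAut_oneAddT_iff]
  constructor
  · rintro ⟨par, coder⟩
    have eq := coder.eq_hat par
    exact ⟨_, hasParity_of_hat (eq ▸ par), eq⟩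
  · rintro ⟨γ, hγ, rfl⟩
    exact ⟨hasParity_hat hγ, isCoderivation_hat hγ⟩

theorem autComponents_oneAddT_hat_red_mul_inc (γ : Cochain 𝒱) (x : Sym (rev 𝒱)) (w : V) :
    autComponents 𝒱 (oneAddT (hat (rev 𝒱) γ)) (red (rev 𝒱) (x * inc (rev 𝒱) w)) =
      (aug (rev 𝒱) x • w, γ (red (rev 𝒱) (x * inc (rev 𝒱) w))) := by
  simp [autComponents, incl_red_of_aug_eq_zero]

theorem lift_bilT_omega_autComponents_coprod {i : ZMod 2} {u : V} (hu : u ∈ rev 𝒱 i) (w : V)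
    (x : Sym (rev 𝒱)) :
    TensorProduct.lift
        ((bilT p (parityOp (rev 𝒱)) (omega 𝒱 B)).compl₁₂
          (autComponents 𝒱 (oneAddT (hat (rev 𝒱) γ)) ∘ₗ red (rev 𝒱) ∘ₗ
            LinearMap.mulRight K (inc (rev 𝒱) u))
          (autComponents 𝒱 (oneAddT (hat (rev 𝒱) γ)) ∘ₗ red (rev 𝒱) ∘ₗ
            LinearMap.mulRight K (inc (rev 𝒱) w) ∘ₗ tw i (symPar (rev 𝒱)).toLinearMap))
        (coprod (rev 𝒱) x) =
      (aug (rev 𝒱) x * omega 𝒱 B u w,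
        omega 𝒱 B (γ (red (rev 𝒱) (x * inc (rev 𝒱) u))) w +
          sgn K (i * p) *
            omega 𝒱 B u (γ (red (rev 𝒱) (symTw (rev 𝒱) i x * inc (rev 𝒱) w)))) := by
  let ω := omega 𝒱 B
  let γ' := γ ∘ₗ red (rev 𝒱)
  let F : Sym (rev 𝒱) →ₗ[K] K × K := LinearMap.prod
    ((aug (rev 𝒱)).toLinearMap.smulRight (ω u w))
    (ω.flip w ∘ₗ γ' ∘ₗ LinearMap.mulRight K (inc (rev 𝒱) u))
  let G : Sym (rev 𝒱) →ₗ[K] K × K := LinearMap.prod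
    0 (sgn K (i * p) • (ω u ∘ₗ γ' ∘ₗ LinearMap.mulRight K (inc (rev 𝒱) w) ∘ₗ symTw (rev 𝒱) i))
  refine (apply_coprod_of_apply_tmul (F := F) (G := G) (fun a b => ?_) x).trans ?_
  · simp [F, G, ω, γ', autComponents_oneAddT_hat_red_mul_inc, bilT, tw_parityOp_of_mem _ hu,
      mul_comm p i]
  · simp [F, G, ω, γ']

theorem autPreserves_oneAddT_hat_iff :
    AutPreserves 𝒱 B p (oneAddT (hat (rev 𝒱) γ)) ↔
      SymCyclic (rev 𝒱) (omega 𝒱 B) p (γ ∘ₗ red (rev 𝒱)) := by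
  constructor
  · intro h i u w x hu
    have coeff := congrArg Prod.snd
      ((lift_bilT_omega_autComponents_coprod hu w (symTw (rev 𝒱) i x)).symm.trans
        (h (symTw (rev 𝒱) i x) i u w hu))
    have twice : symTw (rev 𝒱) i (symTw (rev 𝒱) i x) = x := by
      rw [← tw_add (symPar_involutive (rev 𝒱)), CharTwo.add_self_eq_zero, tw_zero,
        LinearMap.id_apply]
    rw [mul_inc (rev 𝒱) hu, twice] at coeff
    exact eq_neg_of_add_eq_zero_left coeff
  · intro h x i u w hu
    refine (lift_bilT_omega_autComponents_coprod hu w x).trans (Prod.ext rfl ?_)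
    have cyclic := h i u w (symTw (rev 𝒱) i x) hu
    rw [← mul_inc (rev 𝒱) hu] at cyclic
    exact add_eq_zero_iff_eq_neg.2 cyclic

theorem oneAddT_hat_comp_defOp_iff [CharZero K]
    (hl : HasParity (rPar (rev 𝒱)) (parityOp (rev 𝒱)) 1 l)
    (hγ : HasParity (rPar (rev 𝒱)) (parityOp (rev 𝒱)) p γ) :
    (oneAddT (hat (rev 𝒱) γ)).toLinearMap ∘ₗ defOp 𝒱 p l φ =
        defOp 𝒱 p l ψ ∘ₗ (oneAddT (hat (rev 𝒱) γ)).toLinearMap ↔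
      cobd 𝒱 l p γ = ψ - φ := by
  have diff : ∀ z, oneAddT (hat (rev 𝒱) γ) (defOp 𝒱 p l φ z) -
      defOp 𝒱 p l ψ (oneAddT (hat (rev 𝒱) γ) z) =
        (0, hat (rev 𝒱) (cobd 𝒱 l p γ - (ψ - φ)) z.1) := fun z => by
    simp only [oneAddT_apply, defOp_apply, map_add, map_sub, hat_cobd hl hγ, Prod.mk_sub_mk,
      sub_self, LinearMap.sub_apply, LinearMap.smul_apply, LinearMap.comp_apply, smul_add]
    congr 1
    abel
  constructor
  · refine fun h => sub_eq_zero.1 (hat_injective (LinearMap.ext fun x => ?_))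
    rw [map_zero]
    exact congrArg Prod.snd ((diff (x, 0)).symm.trans (sub_eq_zero.2 (LinearMap.congr_fun h _)))
  · refine fun h => LinearMap.ext fun z => sub_eq_zero.1 ((diff z).trans ?_)
    rw [h, sub_self, map_zero, LinearMap.zero_apply, Prod.mk_zero_zero]

theorem equivalent_iff [CharZero K] (hB : IsEvenForm 𝒱 B)
    (hl : HasParity (rPar (rev 𝒱)) (parityOp (rev 𝒱)) 1 l) :
    Equivalent 𝒱 B p l φ ψ ↔ ψ - φ ∈ coboundaries 𝒱 B l (p + 1) := by
  rw [coboundaries, add_assoc, CharTwo.add_self_eq_zero, add_zero]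
  constructor
  · rintro ⟨F, hF, preserves, conj⟩
    obtain ⟨G, rfl⟩ := exists_eq_oneAddT hF.t_linear hF.id_mod_t
    obtain ⟨γ, par, rfl⟩ := isCoalgAut_oneAddT_iff_exists_hat.1 hF
    exact ⟨γ, (mem_CC_iff hB).2 ⟨par, autPreserves_oneAddT_hat_iff.1 preserves⟩,
      (oneAddT_hat_comp_defOp_iff hl par).1 conj⟩
  · rintro ⟨γ, hγ, eq⟩
    obtain ⟨par, cyclic⟩ := (mem_CC_iff hB).1 hγ
    exact ⟨oneAddT (hat (rev 𝒱) γ), isCoalgAut_oneAddT_iff_exists_hat.2 ⟨γ, par, rfl⟩,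
      autPreserves_oneAddT_hat_iff.2 cyclic, (oneAddT_hat_comp_defOp_iff hl par).2 eq⟩

end Automorphisms

end LInf

end

theorem mainTheorem7_general {K : Type*} [Field K] [CharZero K]
    {V : Type*} [AddCommGroup V] [Module K V]
    (𝒱 : ZMod 2 → Submodule K V) [DirectSum.Decomposition 𝒱]
    (B : LinearMap.BilinForm K V) (hB : IsEvenForm 𝒱 B)
    (l : Cochain 𝒱) (hl : IsLInfty 𝒱 l) (hinv : IsCyclicCochain 𝒱 B 1 l) :
    (∀ (r : ZMod 2), ∀ φ ∈ CC 𝒱 B r,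
      cobd 𝒱 l r φ ∈ CC 𝒱 B (r + 1) ∧ cobd 𝒱 l (r + 1) (cobd 𝒱 l r φ) = 0) ∧
    ∀ p : ZMod 2,
      (∀ φ : Cochain 𝒱, φ ∈ cocycles 𝒱 B l (p + 1) ↔
        IsDeformation 𝒱 p l φ ∧ DeformationPreserves 𝒱 B p l φ) ∧
      (∀ φ : Cochain 𝒱, φ ∈ coboundaries 𝒱 B l (p + 1) ↔
        (IsDeformation 𝒱 p l φ ∧ DeformationPreserves 𝒱 B p l φ) ∧
          Equivalent 𝒱 B p l 0 φ) ∧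
      (∀ φ ψ : Deformation 𝒱 B l p,
        Equivalent 𝒱 B p l φ.1 ψ.1 ↔ ψ.1 - φ.1 ∈ coboundaries 𝒱 B l (p + 1)) ∧
      ∃ e : HC 𝒱 B l (p + 1) ≃
          Quot (fun φ ψ : Deformation 𝒱 B l p => Equivalent 𝒱 B p l φ.1 ψ.1),
        ∀ (φ : Cochain 𝒱) (hz : φ ∈ cocycles 𝒱 B l (p + 1))
          (hd : IsDeformation 𝒱 p l φ ∧ DeformationPreserves 𝒱 B p l φ),
          e (Submodule.Quotient.mk ⟨φ, hz⟩) = Quot.mk _ ⟨φ, hd⟩ := by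
  refine ⟨fun r φ hφ => ⟨cobd_mem_CC hB ⟨hl.odd, hinv⟩ hφ, cobd_cobd hl hφ.1⟩, fun p =>
    ⟨fun φ => mem_cocycles_iff hl hinv, fun φ => ?_, fun φ ψ => equivalent_iff hB hl.odd, ?_⟩⟩
  · rw [equivalent_iff hB hl.odd, sub_zero]
    exact ⟨fun h => ⟨(mem_cocycles_iff hl hinv).1 (coboundaries_le_cocycles hB hl hinv _ h), h⟩,
      fun h => h.2⟩
  · refine ⟨Quot.congr (Equiv.subtypeEquivRight fun φ => mem_cocycles_iff hl hinv)
      fun φ ψ => ?_, fun _ _ _ => rfl⟩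
    refine (Submodule.quotientRel_def _).trans (Iff.trans ?_ (equivalent_iff hB hl.odd).symm)
    rw [← neg_mem_iff, neg_sub]
    rfl

theorem mainTheorem7 {K : Type*} [Field K] [CharZero K] {V : Type*} [AddCommGroup V] [Module K V]
    (𝒱 : ZMod 2 → Submodule K V) [DirectSum.Decomposition 𝒱]
    (B : LinearMap.BilinForm K V) (hB : IsInnerProduct 𝒱 B)
    (l : Cochain 𝒱) (hl : IsLInfty 𝒱 l) (hinv : IsCyclicCochain 𝒱 B 1 l) :
    -- the cyclic cochains form a complex
    (∀ (r : ZMod 2), ∀ φ ∈ CC 𝒱 B r,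
      cobd 𝒱 l r φ ∈ CC 𝒱 B (r + 1) ∧ cobd 𝒱 l (r + 1) (cobd 𝒱 l r φ) = 0) ∧
    ∀ p : ZMod 2,
      -- cyclic cocycles are the infinitesimal deformations that preserve the inner product
      (∀ φ : Cochain 𝒱, φ ∈ cocycles 𝒱 B l (p + 1) ↔
        IsDeformation 𝒱 p l φ ∧ DeformationPreserves 𝒱 B p l φ) ∧
      -- cyclic coboundaries are the trivial ones
      (∀ φ : Cochain 𝒱, φ ∈ coboundaries 𝒱 B l (p + 1) ↔
        (IsDeformation 𝒱 p l φ ∧ DeformationPreserves 𝒱 B p l φ) ∧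
          Equivalent 𝒱 B p l 0 φ) ∧
      -- two deformations are equivalent exactly if they differ by a cyclic coboundary
      (∀ φ ψ : Deformation 𝒱 B l p,
        Equivalent 𝒱 B p l φ.1 ψ.1 ↔ ψ.1 - φ.1 ∈ coboundaries 𝒱 B l (p + 1)) ∧
      -- the cyclic cohomology classifies the deformations up to equivalence
      ∃ e : HC 𝒱 B l (p + 1) ≃
          Quot (fun φ ψ : Deformation 𝒱 B l p => Equivalent 𝒱 B p l φ.1 ψ.1),
        ∀ (φ : Cochain 𝒱) (hz : φ ∈ cocycles 𝒱 B l (p + 1))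
          (hd : IsDeformation 𝒱 p l φ ∧ DeformationPreserves 𝒱 B p l φ),
          e (Submodule.Quotient.mk ⟨φ, hz⟩) = Quot.mk _ ⟨φ, hd⟩ :=
  mainTheorem7_general 𝒱 B hB.even l hl hinv
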